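/- \textbf{Setting.} Let $X\subset\mathbb R^D$ be compact and convex with non-empty interior, $\ell(x,y)=\|x-y\|_1$, and let balls be taken relative to $X$. Let $f\sim\mathcal{GP}(0,k)$ be a centred Gaussian process on $X$ with almost surely $C^1$ sample paths, and $f^*=\sup_X f$. Let $K,S\ge 1$, $\sigma,c,\nu,L>0$, $0<\rho<1$, $\delta(h)=c\rho^h$. A $K$-ary hierarchical partition of $X$ is given: node $(h,i)$, $0\le i<K^h$, has a cell, the root cell is $X$, the cell of a node is the disjoint union of the cells of its $K$ children, and each node $m$ carries $S$ representative points $x_{m,1},\dots,x_{m,S}$ of its cell. For every node of depth $h$ and each of its representative points $x$, the cell contains the $\ell$-ball of radius $\nu\delta(h)$ around $x$, and $L\,\ell(x,y)\le\delta(h)$ for all $y$ in the cell. Put $\bar F(m)=\frac1S\sum_s f(x_{m,s})$. \textbf{Algorithm (GPOO).} Inputs: a maximal depth $h_{\max}$, $\theta\in(0,1)$, a budget $N\ge1$. Put $M=\sum_{h=0}^{h_{\max}}K^h$ and $\beta_t=2\log\big(M\pi^2t^2/(6\theta)\big)$. The tree starts with the root $(0,0)$ as its only leaf. In round $t$ a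 leaf $m_t$ maximising $$b_m(t)=\mu_{t-1}(m)+CI_t(m)+\delta(h(m)),\qquad CI_t(m)=\beta_t^{1/2}\,s_{t-1}(m)$$ is selected, where $\mu_{t-1}(m)$ and $s_{t-1}(m)^2$ are the Gaussian-process posterior mean and variance of $\bar F(m)$ given the previous nodes and rewards, and $h(m)$ is the depth of $m$; ties are broken by any measurable rule depending on the past rewards and on randomness independent of $f$ and the noise. The reward $r_t=\bar F(m_t)+\epsilon_t$ is observed, with $\epsilon_t$ i.i.d. $N(0,\sigma^2)$ independent of $f$. If $CI_t(m_t)\le\delta(h(m_t))$ and $h(m_t)<h_{\max}$, then $m_t$ is expanded (replaced as a leaf by its $K$ children). After $N$ rounds any deepest expanded node $m$ (the root, if none was expanded) is recommended; its regret is $R_N=f^*-\bar F(m)$. \textbf{Near-optimality dimension.} For a sample path $f$, $d=d(f)$ is the smallest $d\ge0$ such that for some $C>0$ and all $0<\epsilon\le3\delta(0)$ there are at most $C\epsilon^{-d}$ pairwise disjoint $\ell$-balls of radius $\frac{\nu}{3}\epsilon$ with centres in $\{x\in X: f(x)\ge f^*-\epsilon\}$; any such $C$ is called a corresponding constant. Given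 $d$ and $C$, $h_N$ is the smallest integer $h\ge0$ with $$\frac{N}{\beta_N}\le K\sum_{l=0}^{h}C\,[3\delta(l)]^{-d}\,\frac{\sigma^2}{\delta(l)^2}.$$ \textbf{Claim.} There are positive functions $c_1(d,C)$, $c_2(d,C)$ depending only on $K,\sigma,c,\rho$, and constants $a,b>0$ depending only on $X$ and (the law of) $f$, with $$\mathbb P\Big(\max_j\sup_{x\in X}|\partial_jf(x)|>L'\Big)\le a\,e^{-L'^2b/2}\qquad\text{for all }L'>0,$$ such that for all partitions, parameters, $h_{\max}$, $\theta$, $N$ and tie-breaking rules as above there is an event of probability at least $$1-\theta-\mathbb P\Big(\max_j\sup_{x\in X}|\partial_jf(x)|>L\Big)\ \ge\ 1-\theta-a\,e^{-L^2b/2}$$ on which, if $f$ has near-optimality dimension $d$ with corresponding constant $C$, $$\frac{N}{\beta_N}\le c_1(d,C)\,\delta(h_N)^{-(d+2)},$$ and, if $h_N<h_{\max}$, then $$R_N\le c_2(d,C)\Big(\frac{N}{\beta_N}\Big)^{-1/(d+2)} .$$ -/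

import Mathlib

open MeasureTheory ProbabilityTheory
open scoped Matrix

noncomputable section

namespace GPOO

/-- The distance `ℓ(x, y) = ‖x - y‖₁`. -/
def l1Dist {D : ℕ} (x y : Fin D → ℝ) : ℝ := ∑ j, |x j - y j|

/-- The `ℓ`-ball of radius `r` around `x` in the arm space `X`. -/
def l1Ball {D : ℕ} (X : Set (Fin D → ℝ)) (x : Fin D → ℝ) (r : ℝ) : Set (Fin D → ℝ) :=
  {y ∈ X | l1Dist x y < r}

/-- A `K`-ary hierarchical partition of the arm space `X`.  The nodes of depth `h` are the pairs
`(h, i)` with `0 ≤ i < K ^ h`; the children of `(h, i)` are `(h + 1, K * i + j)` with `0 ≤ j < K`.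
Every node carries a cell and `S` representative points of the cell. -/
structure CellTree (D K S : ℕ) (X : Set (Fin D → ℝ)) where
  cell : ℕ × ℕ → Set (Fin D → ℝ)
  rep : ℕ × ℕ → Fin S → (Fin D → ℝ)
  cell_root : cell (0, 0) = X
  cell_split : ∀ h i, i < K ^ h → cell (h, i) = ⋃ j : Fin K, cell (h + 1, K * i + j)
  cell_disjoint : ∀ h i, i < K ^ h → ∀ j₁ j₂ : Fin K, j₁ ≠ j₂ →
    Disjoint (cell (h + 1, K * i + j₁)) (cell (h + 1, K * i + j₂))
  rep_mem : ∀ h i, i < K ^ h → ∀ s, rep (h, i) s ∈ cell (h, i)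

/-- The children of a node of the `K`-ary tree. -/
def children (K : ℕ) (m : ℕ × ℕ) : Finset (ℕ × ℕ) :=
  (Finset.range K).image fun j => (m.1 + 1, K * m.2 + j)

/-- Exponentially decaying diameters `δ(h) = c ρ ^ h`. -/
def expDiam (c ρ : ℝ) (h : ℕ) : ℝ := c * ρ ^ h

/-- `β_t = 2 log (M π_t / θ)` with `M = ∑_{h ≤ h_max} K ^ h` and `π_t = π² t² / 6`. -/
def beta (K hmax : ℕ) (θ : ℝ) (t : ℕ) : ℝ :=
  2 * Real.log
    ((∑ h ∈ Finset.range (hmax + 1), (K : ℝ) ^ h) * (Real.pi ^ 2 * (t : ℝ) ^ 2 / 6) / θ)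

section Tree

variable {D K S : ℕ} {X : Set (Fin D → ℝ)}

/-- Decreasing diameters: from every representative point, the cell of a node of depth `h` has
`L ℓ`-radius at most `δ(h)`. -/
def DiamBound (T : CellTree D K S X) (L : ℝ) (δ : ℕ → ℝ) : Prop :=
  ∀ h i, i < K ^ h → ∀ s, ∀ y ∈ T.cell (h, i), L * l1Dist (T.rep (h, i) s) y ≤ δ h

/-- Well-shaped cells: the cell of a node of depth `h` contains the `ℓ`-ball of radius `ν δ(h)`
around each of its representative points. -/
def WellShaped (T : CellTree D K S X) (ν : ℝ) (δ : ℕ → ℝ) : Prop :=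
  ∀ h i, i < K ^ h → ∀ s, l1Ball X (T.rep (h, i) s) (ν * δ h) ⊆ T.cell (h, i)

/-- The average `\bar F` of `g` over the representative points of a node. -/
def avg (T : CellTree D K S X) (g : (Fin D → ℝ) → ℝ) (m : ℕ × ℕ) : ℝ :=
  (1 / (S : ℝ)) * ∑ s, g (T.rep m s)

/-! ### Gaussian process regression from aggregated observations

`past : Fin n → ℕ × ℕ` are the nodes that have been evaluated, `y : Fin n → ℝ` the rewards. -/

/-- Prior covariances of `f x` with the aggregated values at the evaluated nodes. -/
def crossCov (T : CellTree D K S X) (k : (Fin D → ℝ) → (Fin D → ℝ) → ℝ) {n : ℕ}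
    (past : Fin n → ℕ × ℕ) (x : Fin D → ℝ) : Fin n → ℝ :=
  fun i => avg T (k x) (past i)

/-- Prior covariance matrix of the rewards: aggregated kernel matrix plus `σ² I`. -/
def obsCov (T : CellTree D K S X) (k : (Fin D → ℝ) → (Fin D → ℝ) → ℝ) (σ : ℝ) {n : ℕ}
    (past : Fin n → ℕ × ℕ) : Matrix (Fin n) (Fin n) ℝ :=
  Matrix.of (fun i j => avg T (fun x => avg T (k x) (past j)) (past i))
    + σ ^ 2 • (1 : Matrix (Fin n) (Fin n) ℝ)

/-- Posterior mean `μ(x | Z)`. -/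
def postMean (T : CellTree D K S X) (k : (Fin D → ℝ) → (Fin D → ℝ) → ℝ) (σ : ℝ) {n : ℕ}
    (past : Fin n → ℕ × ℕ) (y : Fin n → ℝ) (x : Fin D → ℝ) : ℝ :=
  crossCov T k past x ⬝ᵥ ((obsCov T k σ past)⁻¹ *ᵥ y)

/-- Posterior covariance `Σ(x, x' | Z)`. -/
def postCov (T : CellTree D K S X) (k : (Fin D → ℝ) → (Fin D → ℝ) → ℝ) (σ : ℝ) {n : ℕ}
    (past : Fin n → ℕ × ℕ) (x x' : Fin D → ℝ) : ℝ :=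
  k x x' - crossCov T k past x ⬝ᵥ ((obsCov T k σ past)⁻¹ *ᵥ crossCov T k past x')

/-! ### The algorithm

`node t` and `r t` are the node selected and the reward observed in the `(t + 1)`-st round, so that
the data available at the beginning of that round are `(node s, r s)` for `s < t`. -/

/-- Confidence width `CI(m) = β^{1/2} (aᵀ Σ(X_m | Z) a)^{1/2}` in the `(t + 1)`-st round. -/
def ciWidth (T : CellTree D K S X) (k : (Fin D → ℝ) → (Fin D → ℝ) → ℝ) (σ : ℝ) (hmax : ℕ)
    (θ : ℝ) (node : ℕ → ℕ × ℕ) (t : ℕ) (m : ℕ × ℕ) : ℝ :=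
  Real.sqrt (beta K hmax θ (t + 1)) *
    Real.sqrt (avg T (fun x => avg T (postCov T k σ (fun s : Fin t => node s) x) m) m)

/-- The value `b(m) = aᵀ μ(X_m | Z) + CI(m) + δ(h)` in the `(t + 1)`-st round. -/
def bValue (T : CellTree D K S X) (k : (Fin D → ℝ) → (Fin D → ℝ) → ℝ) (σ : ℝ) (δ : ℕ → ℝ)
    (hmax : ℕ) (θ : ℝ) (node : ℕ → ℕ × ℕ) (r : ℕ → ℝ) (t : ℕ) (m : ℕ × ℕ) : ℝ :=
  avg T (postMean T k σ (fun s : Fin t => node s) (fun s : Fin t => r s)) m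
    + ciWidth T k σ hmax θ node t m + δ m.1

/-- The node selected in the `(t + 1)`-st round is expanded in that round. -/
def Expands (T : CellTree D K S X) (k : (Fin D → ℝ) → (Fin D → ℝ) → ℝ) (σ : ℝ) (δ : ℕ → ℝ)
    (hmax : ℕ) (θ : ℝ) (node : ℕ → ℕ × ℕ) (t : ℕ) : Prop :=
  ciWidth T k σ hmax θ node t (node t) ≤ δ (node t).1 ∧ (node t).1 < hmax

open Classical in
/-- The leaves of the tree after `t` rounds. -/
def leaves (T : CellTree D K S X) (k : (Fin D → ℝ) → (Fin D → ℝ) → ℝ) (σ : ℝ) (δ : ℕ → ℝ)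
    (hmax : ℕ) (θ : ℝ) (node : ℕ → ℕ × ℕ) : ℕ → Finset (ℕ × ℕ)
  | 0 => {(0, 0)}
  | t + 1 =>
    if Expands T k σ δ hmax θ node t then
      (leaves T k σ δ hmax θ node t).erase (node t) ∪ children K (node t)
    else leaves T k σ δ hmax θ node t

/-- `node` and `r` are the selections and rewards of an `N`-round run: in every round a leaf with
maximal `b`-value is selected. -/
def IsRun (T : CellTree D K S X) (k : (Fin D → ℝ) → (Fin D → ℝ) → ℝ) (σ : ℝ) (δ : ℕ → ℝ)
    (hmax : ℕ) (θ : ℝ) (N : ℕ) (node : ℕ → ℕ × ℕ) (r : ℕ → ℝ) : Prop :=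
  ∀ t < N, node t ∈ leaves T k σ δ hmax θ node t ∧
    ∀ m ∈ leaves T k σ δ hmax θ node t,
      bValue T k σ δ hmax θ node r t m ≤ bValue T k σ δ hmax θ node r t (node t)

/-- The nodes that have been expanded within `N` rounds. -/
def expandedNodes (T : CellTree D K S X) (k : (Fin D → ℝ) → (Fin D → ℝ) → ℝ) (σ : ℝ) (δ : ℕ → ℝ)
    (hmax : ℕ) (θ : ℝ) (N : ℕ) (node : ℕ → ℕ × ℕ) : Set (ℕ × ℕ) :=
  {m | ∃ t < N, Expands T k σ δ hmax θ node t ∧ node t = m}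

/-- `m` may be recommended after `N` rounds: it is a deepest expanded node, or the root if no node
has been expanded. -/
def IsRecommended (T : CellTree D K S X) (k : (Fin D → ℝ) → (Fin D → ℝ) → ℝ) (σ : ℝ) (δ : ℕ → ℝ)
    (hmax : ℕ) (θ : ℝ) (N : ℕ) (node : ℕ → ℕ × ℕ) (m : ℕ × ℕ) : Prop :=
  (m ∈ expandedNodes T k σ δ hmax θ N node ∧
    ∀ m' ∈ expandedNodes T k σ δ hmax θ N node, m'.1 ≤ m.1) ∨
  (expandedNodes T k σ δ hmax θ N node = ∅ ∧ m = (0, 0))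

/-- Aggregated regret `sup_X g - \bar F(X_m)` of the node `m`, for the reward function `g`. -/
def regret (T : CellTree D K S X) (g : (Fin D → ℝ) → ℝ) (m : ℕ × ℕ) : ℝ :=
  sSup (g '' X) - avg T g m

end Tree

/-- For all scales `0 < ε ≤ ε₀`, at most `C ε ^ (-d)` pairwise disjoint `ℓ`-balls of radius `η ε`
have their centres in `{x ∈ X | g x ≥ sup_X g - ε}`. -/
def PackingBound {D : ℕ} (X : Set (Fin D → ℝ)) (g : (Fin D → ℝ) → ℝ) (η ε₀ d C : ℝ) : Prop :=
  ∀ ε, 0 < ε → ε ≤ ε₀ → ∀ B : Finset (Fin D → ℝ),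
    (∀ x ∈ B, x ∈ X ∧ sSup (g '' X) - ε ≤ g x) →
    (B : Set (Fin D → ℝ)).PairwiseDisjoint (fun x => l1Ball X x (η * ε)) →
    (B.card : ℝ) ≤ C * ε ^ (-d)

/-- `d` is the `η`-near-optimality dimension of `g` (at scales up to `ε₀`): the smallest `d ≥ 0`
for which some constant `C > 0` gives a packing bound. -/
def IsNearOptimalityDim {D : ℕ} (X : Set (Fin D → ℝ)) (g : (Fin D → ℝ) → ℝ) (η ε₀ d : ℝ) : Prop :=
  IsLeast {d' : ℝ | 0 ≤ d' ∧ ∃ C, 0 < C ∧ PackingBound X g η ε₀ d' C} d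

/-- `h_N`: the smallest `h` with `N / β_N ≤ K ∑_{l ≤ h} C (3 δ(l))^{-d} σ² / δ(l)²`. -/
def depthN (K hmax : ℕ) (σ θ : ℝ) (δ : ℕ → ℝ) (d C : ℝ) (N : ℕ) : ℕ :=
  sInf {h : ℕ | (N : ℝ) / beta K hmax θ N ≤
    K * ∑ l ∈ Finset.range (h + 1), C * (3 * δ l) ^ (-d) * (σ ^ 2 / δ l ^ 2)}

/-- Some first partial derivative of `g` exceeds `L` in absolute value somewhere on `X`. -/
def SteepOn {D : ℕ} (X : Set (Fin D → ℝ)) (g : (Fin D → ℝ) → ℝ) (L : ℝ) : Prop :=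
  ∃ x ∈ X, ∃ j : Fin D, L < |fderivWithin ℝ g X x (Pi.single j 1)|

end GPOO

end

noncomputable section

namespace GPOO

open scoped ENNReal

section Fernique

/-- A bound for the exponential square moments in Fernique's theorem that only depends on the
mass `c` of a ball. -/
def ferniqueBound (c : ℝ≥0∞) : ℝ≥0∞ :=
  .ofReal (Real.exp (Fernique.logRatio c))
    + ∑' n : ℕ, .ofReal (Real.exp (-2⁻¹ * Real.log (c / (1 - c)).toReal * 2 ^ n))

lemma ferniqueBound_lt_top {c : ℝ≥0∞} (hc : 2⁻¹ < c) (hc1 : c < 1) : ferniqueBound c < ∞ := by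
  have hct : c < ∞ := hc1.trans ENNReal.one_lt_top
  have hc_one_sub_lt_top : 1 - c < ∞ := lt_top_of_lt (b := 2) (tsub_le_self.trans_lt (by simp))
  have h_one_sub_lt_self : 1 - c < c := by
    refine ENNReal.sub_lt_of_lt_add hc1.le ?_
    rw [← two_mul]
    rwa [inv_eq_one_div, ENNReal.div_lt_iff (by simp) (by simp), mul_comm] at hc
  refine ENNReal.add_lt_top.mpr ⟨ENNReal.ofReal_lt_top, ?_⟩
  refine Summable.tsum_ofReal_lt_top <|
    Real.summable_exp_nat_mul_of_ge ?_ (fun i ↦ mod_cast (Nat.lt_pow_self (by simp)).le)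
  refine mul_neg_of_neg_of_pos (by simp) (Real.log_pos ?_)
  simp only [ENNReal.toReal_div, one_lt_div_iff, ENNReal.toReal_pos_iff, tsub_pos_iff_lt, hc1,
    hc_one_sub_lt_top, and_self, true_and]
  rw [ENNReal.toReal_lt_toReal hc_one_sub_lt_top.ne hct.ne]
  exact .inl h_one_sub_lt_self

variable {Ω : Type*} [MeasurableSpace Ω] {P : Measure Ω}

/-- Gaussian tail of a finite centred Gaussian vector, uniformly in the dimension. -/
lemma measure_lt_norm_le_of_hasGaussianLaw {ι : Type*} [Fintype ι] {V : Ω → ι → ℝ}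
    (hV : HasGaussianLaw V P) (hV0 : ∀ i, ∫ ω, V ω i ∂P = 0) {c : ℝ≥0∞} (hc : 2⁻¹ < c)
    {q : ℝ} (hq : c ≤ P {ω | ‖V ω‖ ≤ q}) (hc1 : c < 1) {L : ℝ} (hL : 0 < L) :
    P {ω | L < ‖V ω‖} ≤
      ferniqueBound c * .ofReal (Real.exp (-(Fernique.logRatio c * q⁻¹ ^ 2 * L ^ 2))) := by
  have hG : IsGaussian (P.map V) := hV.isGaussian_map
  have hm := hV.aemeasurable
  have hint := hV.integrable
  have hdual : ∀ l : StrongDual ℝ (ι → ℝ), (P.map V)[l] = 0 := by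
    intro l
    rw [integral_map hm (by fun_prop), ContinuousLinearMap.integral_comp_comm _ hint]
    have : ∫ ω, V ω ∂P = 0 := by
      ext i
      rw [eval_integral (fun j => hint.eval j), hV0 i]; rfl
    rw [this, map_zero]
  have hq' : c ≤ P.map V {x | ‖x‖ ≤ q} := by
    rw [Measure.map_apply_of_aemeasurable hm (measurableSet_le (by fun_prop) (by fun_prop))]
    exact hq
  have hF := lintegral_exp_mul_sq_norm_le_of_map_rotation_eq_self
    (IsGaussian.map_rotation_eq_self_of_forall_strongDual_eq_zero hdual _) hq' hc
  have hlog : 0 < Fernique.logRatio c := Fernique.logRatio_pos hc hc1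
  set κ := Fernique.logRatio c * q⁻¹ ^ 2
  have hκ : 0 ≤ κ := by positivity
  have hexp : (0 : ℝ) < Real.exp (κ * L ^ 2) := Real.exp_pos _
  have hmk := mul_meas_ge_le_lintegral₀ (μ := P.map V)
    (f := fun x => ENNReal.ofReal (Real.exp (κ * ‖x‖ ^ 2))) (by fun_prop)
    (.ofReal (Real.exp (κ * L ^ 2)))
  have hsub : P {ω | L < ‖V ω‖} ≤
      P.map V {x | ENNReal.ofReal (Real.exp (κ * L ^ 2)) ≤
        ENNReal.ofReal (Real.exp (κ * ‖x‖ ^ 2))} := by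
    rw [Measure.map_apply_of_aemeasurable hm (measurableSet_le (by fun_prop) (by fun_prop))]
    refine measure_mono fun ω hω => ?_
    simp only [Set.mem_ofPred_eq, Set.mem_preimage] at hω ⊢
    gcongr
  rw [Real.exp_neg, ENNReal.ofReal_inv_of_pos hexp, ← div_eq_mul_inv,
    ENNReal.le_div_iff_mul_le (Or.inl (by simpa using hexp)) (Or.inl (by simp)), mul_comm]
  calc _ ≤ _ := by gcongr
    _ ≤ _ := hmk
    _ ≤ _ := hF

/-- **Gaussian tails of suprema**: the supremum of an almost surely bounded sequence of jointly
Gaussian centred random variables has a Gaussian tail. -/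
lemma exists_gaussian_tail_nat [IsProbabilityMeasure P] {Z : ℕ → Ω → ℝ}
    (hZ : IsGaussianProcess Z P) (hZ0 : ∀ i, ∫ ω, Z i ω ∂P = 0)
    (hb : ∀ᵐ ω ∂P, ∃ B, ∀ i, |Z i ω| ≤ B) :
    ∃ a b : ℝ, 0 < a ∧ 0 < b ∧ ∀ L : ℝ, 0 < L →
      P {ω | ∃ i, L < |Z i ω|} ≤ .ofReal (a * Real.exp (-(L ^ 2 * b / 2))) := by
  let c : ℝ≥0∞ := .ofReal (3 / 4)
  have hc : 2⁻¹ < c := by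
    have : (2 : ℝ≥0∞)⁻¹ = .ofReal (1 / 2) := by
      rw [one_div, ENNReal.ofReal_inv_of_pos (by norm_num)]; simp
    rw [this]; exact (ENNReal.ofReal_lt_ofReal_iff (by norm_num)).2 (by norm_num)
  have hc1 : c < 1 := by
    rw [← ENNReal.ofReal_one]; exact (ENNReal.ofReal_lt_ofReal_iff (by norm_num)).2 (by norm_num)
  obtain ⟨q, hq0, hq⟩ : ∃ q : ℝ, 0 < q ∧ c ≤ P {ω | ∀ i, |Z i ω| ≤ q} := by
    have hmono : Monotone fun n : ℕ => {ω | ∀ i, |Z i ω| ≤ (n : ℝ)} := by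
      intro n m hnm ω hω i
      exact (hω i).trans (by exact_mod_cast hnm)
    have ht := tendsto_measure_iUnion_atTop (μ := P) hmono
    have hU : P (⋃ n : ℕ, {ω | ∀ i, |Z i ω| ≤ (n : ℝ)}) = 1 := by
      rw [← measure_univ (μ := P)]
      refine measure_congr ?_
      filter_upwards [hb] with ω ⟨B, hB⟩
      refine propext ⟨fun _ => trivial, fun _ => ?_⟩
      obtain ⟨n, hn⟩ := exists_nat_ge B
      exact Set.mem_iUnion.2 ⟨n, fun i => (hB i).trans hn⟩
    rw [hU] at ht
    have h1 := (ht.eventually (lt_mem_nhds hc1)).and (Filter.eventually_gt_atTop 0)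
    obtain ⟨n, hn, hn0⟩ := h1.exists
    exact ⟨n, by exact_mod_cast hn0, hn.le⟩
  have hlog : 0 < Fernique.logRatio c := Fernique.logRatio_pos hc hc1
  have hA := ferniqueBound_lt_top hc hc1
  refine ⟨(ferniqueBound c).toReal + 1, 2 * (Fernique.logRatio c * q⁻¹ ^ 2), by positivity,
    by positivity, fun L hL => ?_⟩
  have hmono : Monotone fun n : ℕ => {ω | ∃ i ∈ Finset.range n, L < |Z i ω|} := by
    rintro n m hnm ω ⟨i, hi, h⟩
    exact ⟨i, Finset.range_mono hnm hi, h⟩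
  have hUn : {ω | ∃ i, L < |Z i ω|} = ⋃ n : ℕ, {ω | ∃ i ∈ Finset.range n, L < |Z i ω|} := by
    ext ω
    simp only [Set.mem_ofPred_eq, Set.mem_iUnion]
    exact ⟨fun ⟨i, h⟩ => ⟨i + 1, i, by simp, h⟩, fun ⟨_, i, _, h⟩ => ⟨i, h⟩⟩
  rw [hUn]
  refine le_of_tendsto' (tendsto_measure_iUnion_atTop (μ := P) hmono) fun n => ?_
  have hV := hZ.hasGaussianLaw (Finset.range n)
  have hmain := measure_lt_norm_le_of_hasGaussianLaw hV (fun i => hZ0 i) hc (q := q) ?_ hc1 hL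
  · have hset : {ω | ∃ i ∈ Finset.range n, L < |Z i ω|} =
        {ω | L < ‖(Finset.range n).restrict (Z · ω)‖} := by
      ext ω
      simp only [Set.mem_ofPred_eq]
      rw [← not_iff_not, not_lt, pi_norm_le_iff_of_nonneg hL.le]
      simp
    simp only [Function.comp_apply, hset]
    refine hmain.trans ?_
    rw [ENNReal.ofReal_mul (by positivity)]
    have e : Fernique.logRatio c * q⁻¹ ^ 2 * L ^ 2 =
      L ^ 2 * (2 * (Fernique.logRatio c * q⁻¹ ^ 2)) / 2 := by ring
    rw [e]
    gcongr
    rw [← ENNReal.ofReal_toReal hA.ne]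
    exact ENNReal.ofReal_le_ofReal (by simp)
  · refine hq.trans (measure_mono fun ω hω => ?_)
    simp only [Set.mem_ofPred_eq]
    rw [pi_norm_le_iff_of_nonneg hq0.le]
    exact fun i => hω i

lemma exists_gaussian_tail [IsProbabilityMeasure P] {ι : Type*} [Countable ι] {Z : ι → Ω → ℝ}
    (hZ : IsGaussianProcess Z P) (hZ0 : ∀ i, ∫ ω, Z i ω ∂P = 0)
    (hb : ∀ᵐ ω ∂P, ∃ B, ∀ i, |Z i ω| ≤ B) :
    ∃ a b : ℝ, 0 < a ∧ 0 < b ∧ ∀ L : ℝ, 0 < L →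
      P {ω | ∃ i, L < |Z i ω|} ≤ .ofReal (a * Real.exp (-(L ^ 2 * b / 2))) := by
  rcases isEmpty_or_nonempty ι with h | h
  · exact ⟨1, 1, one_pos, one_pos, fun L _ => by simp⟩
  obtain ⟨e, he⟩ := exists_surjective_nat ι
  obtain ⟨a, b, ha, hb', H⟩ := exists_gaussian_tail_nat (hZ.comp_right e) (fun i => hZ0 (e i))
    (by filter_upwards [hb] with ω ⟨B, hB⟩; exact ⟨B, fun i => hB (e i)⟩)
  refine ⟨a, b, ha, hb', fun L hL => (measure_mono ?_).trans (H L hL)⟩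
  rintro ω ⟨i, hi⟩
  obtain ⟨n, rfl⟩ := he i
  exact ⟨n, hi⟩

end Fernique

end GPOO

end

noncomputable section

namespace GPOO

open scoped ENNReal Topology
open Filter

section Gradient

variable {D : ℕ} {X : Set (Fin D → ℝ)} {g : (Fin D → ℝ) → ℝ}

/-- Segments in `X` parallel to a coordinate axis, with their initial point and signed length. -/
def AxisSegment (X : Set (Fin D → ℝ)) : Type :=
  {q : (Fin D → ℝ) × ℝ × Fin D // q.1 ∈ X ∧ q.1 + q.2.1 • Pi.single q.2.2 (1 : ℝ) ∈ X ∧ q.2.1 ≠ 0}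

instance : TopologicalSpace (AxisSegment X) := inferInstanceAs (TopologicalSpace (Subtype _))

instance : SecondCountableTopology (AxisSegment X) :=
  (Topology.IsEmbedding.subtypeVal (X := (Fin D → ℝ) × ℝ × Fin D)).secondCountableTopology

/-- Initial point of a segment. -/
def AxisSegment.left (q : AxisSegment X) : Fin D → ℝ := q.1.1

/-- Final point of a segment. -/
def AxisSegment.right (q : AxisSegment X) : Fin D → ℝ :=
  q.1.1 + q.1.2.1 • Pi.single q.1.2.2 (1 : ℝ)

/-- Signed length of a segment. -/
def AxisSegment.len (q : AxisSegment X) : ℝ := q.1.2.1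

lemma AxisSegment.left_mem (q : AxisSegment X) : q.left ∈ X := q.2.1

lemma AxisSegment.right_mem (q : AxisSegment X) : q.right ∈ X := q.2.2.1

lemma AxisSegment.len_ne_zero (q : AxisSegment X) : q.len ≠ 0 := q.2.2.2

/-- Difference quotient of `g` along a segment. -/
def AxisSegment.quot (g : (Fin D → ℝ) → ℝ) (q : AxisSegment X) : ℝ :=
  q.len⁻¹ * (g q.right - g q.left)

lemma AxisSegment.continuous_left : Continuous (AxisSegment.left (X := X)) :=
  continuous_fst.comp continuous_subtype_val

lemma AxisSegment.continuous_len : Continuous (AxisSegment.len (X := X)) :=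
  continuous_fst.comp (continuous_snd.comp continuous_subtype_val)

lemma AxisSegment.continuous_right : Continuous (AxisSegment.right (X := X)) := by
  have h : Continuous fun q : AxisSegment X => (Pi.single q.1.2.2 (1 : ℝ) : Fin D → ℝ) :=
    (continuous_of_discreteTopology (f := fun j : Fin D => (Pi.single j (1 : ℝ) : Fin D → ℝ))).comp
      (continuous_snd.comp (continuous_snd.comp continuous_subtype_val))
  exact continuous_left.add (continuous_len.smul h)

lemma AxisSegment.continuous_quot (hg : ContinuousOn g X) :
    Continuous (AxisSegment.quot (X := X) g) :=
  (continuous_len.inv₀ fun q => q.len_ne_zero).mul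
    ((hg.comp_continuous continuous_right right_mem).sub
      (hg.comp_continuous continuous_left left_mem))

lemma exists_axisSegment_lt_abs_quot (hXc : Convex ℝ X) (hXi : (interior X).Nonempty)
    (hg : ContDiffOn ℝ 1 g X) {L : ℝ} (hs : SteepOn X g L) :
    ∃ q : AxisSegment X, L < |q.quot g| := by
  obtain ⟨x, hx, j, hL⟩ := hs
  have hU : UniqueDiffOn ℝ X := uniqueDiffOn_convex hXc hXi
  have hcont : ContinuousOn (fun y => |fderivWithin ℝ g X y (Pi.single j 1)|) X :=
    ((hg.continuousOn_fderivWithin hU le_rfl).clm_apply continuousOn_const).abs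
  have hev : ∀ᶠ y in 𝓝[X] x, L < |fderivWithin ℝ g X y (Pi.single j 1)| :=
    (hcont x hx).eventually (lt_mem_nhds hL)
  have hcl : x ∈ closure (interior X) := by
    rw [hXc.closure_interior_eq_closure_of_nonempty_interior hXi]
    exact subset_closure hx
  obtain ⟨y, hy, hyL⟩ : ∃ y ∈ interior X, L < |fderivWithin ℝ g X y (Pi.single j 1)| := by
    have h1 : (𝓝[interior X] x).NeBot := mem_closure_iff_nhdsWithin_neBot.1 hcl
    have h2 := hev.filter_mono (nhdsWithin_mono x interior_subset)
    obtain ⟨y, h3, h4⟩ := (h2.and self_mem_nhdsWithin).exists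
    exact ⟨y, h4, h3⟩
  have hyn : X ∈ 𝓝 y := mem_interior_iff_mem_nhds.1 hy
  have hd : HasFDerivAt g (fderivWithin ℝ g X y) y :=
    ((hg.differentiableOn one_ne_zero) y (interior_subset hy)).hasFDerivWithinAt.hasFDerivAt hyn
  have hl := (hd.hasLineDerivAt (Pi.single j (1 : ℝ))).tendsto_slope_zero
  have hev2 := hl.abs.eventually (lt_mem_nhds hyL)
  have hc : Continuous fun t : ℝ => y + t • (Pi.single j (1 : ℝ) : Fin D → ℝ) := by fun_prop
  have hev3 : ∀ᶠ t : ℝ in 𝓝[≠] 0, y + t • (Pi.single j (1 : ℝ) : Fin D → ℝ) ∈ X := by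
    refine (hc.continuousAt.eventually ?_).filter_mono nhdsWithin_le_nhds
    simpa using hyn
  obtain ⟨t, ⟨h1, h2⟩, h3⟩ := ((hev2.and hev3).and self_mem_nhdsWithin).exists
  refine ⟨⟨(y, t, j), interior_subset hy, h2, h3⟩, ?_⟩
  simpa [AxisSegment.quot, AxisSegment.left, AxisSegment.right, AxisSegment.len] using h1

lemma exists_forall_abs_quot_le (hX : IsCompact X) (hXc : Convex ℝ X)
    (hXi : (interior X).Nonempty) (hg : ContDiffOn ℝ 1 g X) :
    ∃ B, ∀ q : AxisSegment X, |q.quot g| ≤ B := by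
  have hU : UniqueDiffOn ℝ X := uniqueDiffOn_convex hXc hXi
  obtain ⟨B, hB⟩ := hX.exists_bound_of_continuousOn (hg.continuousOn_fderivWithin hU le_rfl)
  refine ⟨B, fun q => ?_⟩
  have h := hXc.norm_image_sub_le_of_norm_fderivWithin_le (hg.differentiableOn one_ne_zero) hB
    q.left_mem q.right_mem
  have hn : ‖q.right - q.left‖ ≤ |q.len| := by
    simp only [AxisSegment.right, AxisSegment.left, AxisSegment.len, add_sub_cancel_left,
      norm_smul, Real.norm_eq_abs]
    have : ‖(Pi.single q.1.2.2 (1 : ℝ) : Fin D → ℝ)‖ = 1 := by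
      rw [Pi.norm_single, norm_one]
    rw [this, mul_one]
  have hB0 : 0 ≤ B := (norm_nonneg _).trans (hB q.left q.left_mem)
  have hpos : 0 < |q.len| := abs_pos.2 q.len_ne_zero
  rw [AxisSegment.quot, abs_mul, abs_inv, inv_mul_le_iff₀ hpos, mul_comm]
  exact h.trans (by gcongr)

lemma abs_sub_le_of_not_steepOn (hXc : Convex ℝ X)
    (hg : ContDiffOn ℝ 1 g X) {L : ℝ} (hs : ¬ SteepOn X g L) {x y : Fin D → ℝ}
    (hx : x ∈ X) (hy : y ∈ X) : |g x - g y| ≤ L * l1Dist x y := by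
  simp only [SteepOn, not_exists, not_and, not_lt] at hs
  have hlin : ∀ z ∈ X, ∀ v : Fin D → ℝ, |fderivWithin ℝ g X z v| ≤ L * ∑ j, |v j| := by
    intro z hz v
    have hv : v = ∑ j, v j • (Pi.single j (1 : ℝ) : Fin D → ℝ) := by
      ext i; simp [Finset.sum_apply, Pi.single_apply]
    conv_lhs => rw [hv]
    rw [map_sum, Finset.mul_sum]
    refine (Finset.abs_sum_le_sum_abs _ _).trans (Finset.sum_le_sum fun j _ => ?_)
    rw [map_smul, smul_eq_mul, abs_mul, mul_comm]
    exact mul_le_mul_of_nonneg_right (hs z hz j) (abs_nonneg _)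
  let γ : ℝ → (Fin D → ℝ) := fun t => y + t • (x - y)
  have hγ : ∀ t ∈ Set.Icc (0 : ℝ) 1, γ t ∈ X := fun t ht => hXc.add_smul_sub_mem hy hx ht
  have hγd : ∀ t, HasDerivWithinAt γ (x - y) (Set.Icc (0 : ℝ) 1) t := by
    intro t
    have := ((hasDerivAt_id t).smul_const (x - y)).const_add y
    rw [one_smul] at this
    exact this.hasDerivWithinAt
  have hd : ∀ t ∈ Set.Icc (0 : ℝ) 1, HasDerivWithinAt (g ∘ γ)
      (fderivWithin ℝ g X (γ t) (x - y)) (Set.Icc (0 : ℝ) 1) t := by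
    intro t ht
    have h1 := ((hg.differentiableOn one_ne_zero) (γ t) (hγ t ht)).hasFDerivWithinAt
    exact h1.comp_hasDerivWithinAt t (hγd t) hγ
  have h := norm_image_sub_le_of_norm_deriv_le_segment_01' hd (C := L * l1Dist x y) fun t ht => by
    simpa [l1Dist] using hlin (γ t) (hγ t (Set.Ico_subset_Icc_self ht)) (x - y)
  simpa [γ] using h

end Gradient

/-- The gradient of a centred Gaussian process with continuously differentiable paths has Gaussian
tails. -/
lemma exists_steepOn_tail {D : ℕ} {X : Set (Fin D → ℝ)} (hX : IsCompact X) (hXc : Convex ℝ X)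
    (hXi : (interior X).Nonempty) {Ω : Type*} [MeasurableSpace Ω] {P : Measure Ω}
    [IsProbabilityMeasure P] {f : (Fin D → ℝ) → Ω → ℝ}
    (hG : IsGaussianProcess (fun (x : X) => f x) P) (h0 : ∀ x ∈ X, ∫ ω, f x ω ∂P = 0)
    (hf : ∀ᵐ ω ∂P, ContDiffOn ℝ 1 (fun x => f x ω) X) :
    ∃ a b : ℝ, 0 < a ∧ 0 < b ∧ ∀ L : ℝ, 0 < L →
      P.real {ω | SteepOn X (fun x => f x ω) L} ≤ a * Real.exp (-(L ^ 2 * b / 2)) := by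
  classical
  obtain ⟨s, hsc, hsd⟩ := TopologicalSpace.exists_countable_dense (AxisSegment X)
  have : Countable s := hsc
  let Z : s → Ω → ℝ := fun q ω => q.1.quot fun x => f x ω
  have hZ : IsGaussianProcess Z P := hG.of_isGaussianProcess fun q =>
    ⟨{⟨q.1.left, q.1.left_mem⟩, ⟨q.1.right, q.1.right_mem⟩},
      q.1.len⁻¹ • (.proj ⟨⟨q.1.right, q.1.right_mem⟩, by simp⟩
        - .proj ⟨⟨q.1.left, q.1.left_mem⟩, by simp⟩),
      fun ω => by simp [Z, AxisSegment.quot]⟩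
  have hint : ∀ x ∈ X, Integrable (f x) P := fun x hx => (hG.hasGaussianLaw_eval ⟨x, hx⟩).integrable
  have hZ0 : ∀ q, ∫ ω, Z q ω ∂P = 0 := by
    intro q
    simp only [Z, AxisSegment.quot]
    rw [integral_const_mul, integral_sub (hint _ q.1.right_mem) (hint _ q.1.left_mem),
      h0 _ q.1.right_mem, h0 _ q.1.left_mem, sub_zero, mul_zero]
  obtain ⟨a, b, ha, hb, H⟩ := exists_gaussian_tail hZ hZ0 (by
    filter_upwards [hf] with ω hω
    obtain ⟨B, hB⟩ := exists_forall_abs_quot_le hX hXc hXi hω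
    exact ⟨B, fun q => hB q.1⟩)
  refine ⟨a, b, ha, hb, fun L hL => ?_⟩
  refine ENNReal.toReal_le_of_le_ofReal (by positivity) (le_trans (measure_mono_ae ?_) (H L hL))
  filter_upwards [hf] with ω hω hs
  obtain ⟨q, hq⟩ := exists_axisSegment_lt_abs_quot hXc hXi hω hs
  have hopen : IsOpen {q : AxisSegment X | L < |q.quot fun x => f x ω|} :=
    isOpen_lt continuous_const (AxisSegment.continuous_quot hω.continuousOn).abs
  obtain ⟨q', hq', hs'⟩ := hsd.exists_mem_open hopen ⟨q, hq⟩
  exact ⟨⟨q', hq'⟩, hs'⟩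

end GPOO

end

noncomputable section

namespace GPOO

open scoped ENNReal

section GaussianSpan

variable {Ω : Type*} [mΩ : MeasurableSpace Ω] {P : Measure Ω}

/-- Random variables in the linear span of a Gaussian process form a Gaussian process. -/
lemma isGaussianProcess_of_mem_span {S T : Type*} {G : T → Ω → ℝ} (hG : IsGaussianProcess G P)
    {Z : S → Ω → ℝ} (hZ : ∀ s, Z s ∈ Submodule.span ℝ (Set.range G)) :
    IsGaussianProcess Z P := by
  refine hG.of_isGaussianProcess fun s => ?_
  obtain ⟨a, ha⟩ := (Finsupp.mem_span_range_iff_exists_finsupp).1 (hZ s)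
  refine ⟨a.support, ∑ i : a.support, a i • .proj i, fun ω => ?_⟩
  rw [← ha]
  simp only [Finsupp.sum, Finset.sum_apply, Pi.smul_apply, smul_eq_mul,
    FunLike.coe_sum, FunLike.coe_smul, ContinuousLinearMap.proj_apply, Finset.restrict]
  exact (Finset.sum_coe_sort a.support fun i => a i * G i ω).symm

/-- Random variables in the linear span of a centred Gaussian process are centred. -/
lemma integral_eq_zero_of_mem_span {T : Type*} {G : T → Ω → ℝ} (hG : IsGaussianProcess G P)
    (h0 : ∀ t, ∫ ω, G t ω ∂P = 0) {Z : Ω → ℝ} (hZ : Z ∈ Submodule.span ℝ (Set.range G)) :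
    ∫ ω, Z ω ∂P = 0 := by
  obtain ⟨a, rfl⟩ := (Finsupp.mem_span_range_iff_exists_finsupp).1 hZ
  simp only [Finsupp.sum, Finset.sum_apply, Pi.smul_apply, smul_eq_mul]
  rw [integral_finsetSum _ fun i _ => (hG.hasGaussianLaw_eval i).integrable.const_mul _]
  simp [integral_const_mul, h0]

lemma hasGaussianLaw_of_mem_span {T : Type*} {G : T → Ω → ℝ} (hG : IsGaussianProcess G P)
    {Z : Ω → ℝ} (hZ : Z ∈ Submodule.span ℝ (Set.range G)) : HasGaussianLaw Z P :=
  (isGaussianProcess_of_mem_span hG (Z := fun _ : Unit => Z) fun _ => hZ).hasGaussianLaw_eval ()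

/-- Two independent Gaussian processes are jointly Gaussian. -/
lemma isGaussianProcess_sumElim {S T : Type*} {X : S → Ω → ℝ} {Y : T → Ω → ℝ}
    (hX : IsGaussianProcess X P) (hY : IsGaussianProcess Y P)
    (h : ∀ (I : Finset S) (J : Finset T),
      IndepFun (fun ω => I.restrict (X · ω)) (fun ω => J.restrict (Y · ω)) P) :
    IsGaussianProcess (Sum.elim X Y) P where
  hasGaussianLaw I := by
    have hXY := (h I.toLeft I.toRight).hasGaussianLaw (hX.hasGaussianLaw _) (hY.hasGaussianLaw _)
    let L : ((I.toLeft → ℝ) × (I.toRight → ℝ)) →L[ℝ] (I → ℝ) := ContinuousLinearMap.pi fun i =>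
      match i with
      | ⟨.inl s, hs⟩ => (ContinuousLinearMap.proj ⟨s, Finset.mem_toLeft.2 hs⟩).comp (.fst ℝ _ _)
      | ⟨.inr t, ht⟩ => (ContinuousLinearMap.proj ⟨t, Finset.mem_toRight.2 ht⟩).comp (.snd ℝ _ _)
    have e : (fun ω => I.restrict (Sum.elim X Y · ω)) =
        fun ω => L (I.toLeft.restrict (X · ω), I.toRight.restrict (Y · ω)) := by
      ext ω ⟨i, hi⟩
      cases i <;> rfl
    rw [e]
    exact hXY.map_fun L

end GaussianSpan

section Regression

variable {Ω : Type*} [mΩ : MeasurableSpace Ω] {P : Measure Ω}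
  {n : ℕ} {F : Ω → ℝ} {Y : Fin n → Ω → ℝ} {A : Matrix (Fin n) (Fin n) ℝ} {q w : Fin n → ℝ}

lemma memLp_lincomb (hY : ∀ i, MemLp (Y i) 2 P) (u : Fin n → ℝ) :
    MemLp (fun ω => ∑ i, u i * Y i ω) 2 P :=
  memLp_finsetSum _ fun i _ => (hY i).const_mul (u i)

lemma covariance_residual_eq_zero [IsProbabilityMeasure P] (hF : MemLp F 2 P)
    (hY : ∀ i, MemLp (Y i) 2 P)
    (hA : ∀ i j, cov[Y i, Y j; P] = A i j) (hq : ∀ j, cov[F, Y j; P] = q j)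
    (hw : w ᵥ* A = q) (j : Fin n) :
    cov[fun ω => F ω - ∑ i, w i * Y i ω, Y j; P] = 0 := by
  rw [covariance_fun_sub_left hF (memLp_lincomb hY w) (hY j),
    covariance_fun_sum_left (fun i => (hY i).const_mul (w i)) (hY j), hq, ← hw, sub_eq_zero]
  simp only [covariance_const_mul_left, hA]
  rfl

lemma variance_residual [IsProbabilityMeasure P] (hF : MemLp F 2 P) (hY : ∀ i, MemLp (Y i) 2 P)
    (hA : ∀ i j, cov[Y i, Y j; P] = A i j) (hq : ∀ j, cov[F, Y j; P] = q j)
    (hw : w ᵥ* A = q) :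
    Var[fun ω => F ω - ∑ i, w i * Y i ω; P] = Var[F; P] - w ⬝ᵥ q := by
  have hs := memLp_lincomb hY w
  have hr : MemLp (fun ω => F ω - ∑ i, w i * Y i ω) 2 P := hF.sub hs
  have h0 := covariance_residual_eq_zero hF hY hA hq hw
  rw [← covariance_self hr.aemeasurable, covariance_fun_sub_right hr hF hs,
    covariance_fun_sum_right (fun i => (hY i).const_mul (w i)) hr]
  simp only [covariance_const_mul_right, h0, mul_zero, Finset.sum_const_zero, sub_zero]
  rw [covariance_fun_sub_left hF hs hF, covariance_self hF.aemeasurable,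
    covariance_fun_sum_left (fun i => (hY i).const_mul (w i)) hF]
  simp only [covariance_const_mul_left, covariance_comm (Y _) F, hq]
  rfl

/-- The linear predictor is optimal in mean square. -/
lemma variance_residual_le [IsProbabilityMeasure P] (hF : MemLp F 2 P) (hY : ∀ i, MemLp (Y i) 2 P)
    (hA : ∀ i j, cov[Y i, Y j; P] = A i j) (hq : ∀ j, cov[F, Y j; P] = q j)
    (hw : w ᵥ* A = q) (u : Fin n → ℝ) :
    Var[fun ω => F ω - ∑ i, w i * Y i ω; P] ≤ Var[fun ω => F ω - ∑ i, u i * Y i ω; P] := by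
  have hr : MemLp (fun ω => F ω - ∑ i, w i * Y i ω) 2 P := hF.sub (memLp_lincomb hY w)
  have h0 := covariance_residual_eq_zero hF hY hA hq hw
  have hd := memLp_lincomb hY (w - u)
  have e : (fun ω => F ω - ∑ i, u i * Y i ω) =
      (fun ω => F ω - ∑ i, w i * Y i ω) + fun ω => ∑ i, (w - u) i * Y i ω := by
    ext ω
    simp only [Pi.add_apply, Pi.sub_apply, sub_mul, Finset.sum_sub_distrib]
    ring
  rw [e, variance_add hr hd, covariance_fun_sum_right (fun i => (hY i).const_mul _) hr]
  simp only [covariance_const_mul_right, h0, mul_zero, Finset.sum_const_zero, add_zero]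
  linarith [variance_nonneg (fun ω => ∑ i, (w - u) i * Y i ω) P]

end Regression

section Tail

/-- Tail bound for the standard normal distribution. -/
lemma gaussianReal_Ioi_le {x : ℝ} (hx : 0 ≤ x) :
    (gaussianReal 0 1) (Set.Ioi x) ≤
      .ofReal (Real.exp (-(x ^ 2 / 2))) * (gaussianReal 0 1) (Set.Ioi 0) := by
  rw [gaussianReal_apply _ one_ne_zero, gaussianReal_apply _ one_ne_zero]
  have e : Set.Ioi x = (fun u => u + x) '' Set.Ioi 0 := by simp
  rw [← lintegral_const_mul _ (by fun_prop), e,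
    ← (measurePreserving_add_right volume x).setLIntegral_comp_emb
      (measurableEmbedding_addRight x)]
  refine setLIntegral_mono (by fun_prop) fun u hu => ?_
  have hu' : 0 < u := hu
  rw [gaussianPDF, gaussianPDF, ← ENNReal.ofReal_mul (by positivity)]
  refine ENNReal.ofReal_le_ofReal ?_
  simp only [gaussianPDFReal]
  rw [mul_left_comm, ← Real.exp_add]
  gcongr
  simp only [NNReal.coe_one]
  nlinarith

lemma gaussianReal_lt_abs_le {x : ℝ} (hx : 0 ≤ x) :
    (gaussianReal 0 1) {z | x < |z|} ≤ .ofReal (Real.exp (-(x ^ 2 / 2))) := by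
  have hsym : ∀ s : ℝ, (gaussianReal 0 1) (Set.Iio (-s)) = (gaussianReal 0 1) (Set.Ioi s) := by
    intro s
    have h := gaussianReal_map_neg (μ := 0) (v := 1)
    rw [neg_zero] at h
    conv_rhs => rw [← h]
    rw [Measure.map_apply (by fun_prop) measurableSet_Ioi]
    congr 1
    ext z; simp
  have hset : {z : ℝ | x < |z|} = Set.Ioi x ∪ Set.Iio (-x) := by
    ext z; simp [lt_abs, lt_neg]
  have h2 : (gaussianReal 0 1) (Set.Ioi 0) + (gaussianReal 0 1) (Set.Ioi 0) ≤ 1 := by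
    nth_rewrite 1 [← hsym 0]
    have hd : Disjoint (Set.Iio (0 : ℝ)) (Set.Ioi 0) :=
      Set.disjoint_left.2 fun a h1 h2 => lt_asymm (Set.mem_Iio.1 h1) h2
    rw [neg_zero, ← measure_union hd measurableSet_Ioi]
    exact prob_le_one
  calc _ ≤ (gaussianReal 0 1) (Set.Ioi x) + (gaussianReal 0 1) (Set.Iio (-x)) := by
        rw [hset]; exact measure_union_le _ _
    _ = (gaussianReal 0 1) (Set.Ioi x) + (gaussianReal 0 1) (Set.Ioi x) := by rw [hsym]
    _ ≤ .ofReal (Real.exp (-(x ^ 2 / 2))) *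
        ((gaussianReal 0 1) (Set.Ioi 0) + (gaussianReal 0 1) (Set.Ioi 0)) := by
        rw [mul_add]; gcongr <;> exact gaussianReal_Ioi_le hx
    _ ≤ .ofReal (Real.exp (-(x ^ 2 / 2))) * 1 := by gcongr
    _ = _ := mul_one _

/-- A centred Gaussian variable exceeds `√β` standard deviations with probability at most
`exp (-β / 2)`. -/
lemma measure_sqrt_lt_abs_le {Ω : Type*} [MeasurableSpace Ω] {P : Measure Ω} {W : Ω → ℝ}
    (hW : HasGaussianLaw W P) (h0 : ∫ ω, W ω ∂P = 0) {β : ℝ} (hβ : 0 ≤ β) :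
    P {ω | Real.sqrt β * Real.sqrt Var[W; P] < |W ω|} ≤ .ofReal (Real.exp (-(β / 2))) := by
  set v := Var[W; P] with hv
  have hv0 : 0 ≤ v := variance_nonneg _ _
  have hmap : P.map W = (gaussianReal 0 1).map (Real.sqrt v * ·) := by
    rw [hW.map_eq_gaussianReal, h0, gaussianReal_map_const_mul, mul_zero]
    congr 1
    ext
    simp [Real.sq_sqrt hv0, hv0, ← hv]
  have hms : MeasurableSet {z : ℝ | Real.sqrt β * Real.sqrt v < |z|} :=
    measurableSet_lt (by fun_prop) (by fun_prop)
  have h1 : P {ω | Real.sqrt β * Real.sqrt v < |W ω|} =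
      P.map W {z | Real.sqrt β * Real.sqrt v < |z|} := by
    rw [Measure.map_apply_of_aemeasurable hW.aemeasurable hms]; rfl
  rw [h1, hmap, Measure.map_apply (by fun_prop) hms]
  have h2 := gaussianReal_lt_abs_le (Real.sqrt_nonneg β)
  rw [Real.sq_sqrt hβ] at h2
  refine (measure_mono fun z hz => ?_).trans h2
  simp only [Set.mem_preimage, Set.mem_ofPred_eq, abs_mul,
    abs_of_nonneg (Real.sqrt_nonneg v)] at hz ⊢
  by_contra hcon
  push Not at hcon
  have := mul_le_mul_of_nonneg_left hcon (Real.sqrt_nonneg v)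
  linarith [mul_comm (Real.sqrt β) (Real.sqrt v)]

end Tail

section Adaptive

variable {Ω : Type*}

/-- If the choices up to time `t` are adapted to the observed rewards, then the event that these
choices are a prescribed sequence is measurable with respect to the rewards of that sequence. -/
lemma measurableSet_forall_eq {α : Type*} {𝒢 : MeasurableSpace Ω} {node : ℕ → Ω → α}
    {r y : ℕ → Ω → ℝ} {p : ℕ → α} (t : ℕ)
    (hy : ∀ s < t, ∀ ω, node s ω = p s → r s ω = y s ω)
    (hn : ∀ s < t, ∀ m, MeasurableSet[𝒢 ⊔ ⨆ u ∈ Finset.range s,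
      MeasurableSpace.comap (r u) inferInstance] {ω | node s ω = m}) :
    MeasurableSet[𝒢 ⊔ ⨆ u ∈ Finset.range t, MeasurableSpace.comap (y u) inferInstance]
      {ω | ∀ s < t, node s ω = p s} := by
  induction t with
  | zero => simp
  | succ t ih =>
    set E := {ω | ∀ s < t, node s ω = p s} with hE
    have ih' := ih (fun s hs => hy s (hs.trans t.lt_succ_self))
      fun s hs => hn s (hs.trans t.lt_succ_self)
    let m : MeasurableSpace Ω :=
      𝒢 ⊔ ⨆ u ∈ Finset.range t, MeasurableSpace.comap (y u) inferInstance
    let tr : MeasurableSpace Ω :=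
      { MeasurableSet' := fun A => MeasurableSet[m] (A ∩ E)
        measurableSet_empty := by simp
        measurableSet_compl := fun A hA => by
          have : Aᶜ ∩ E = E \ (A ∩ E) := by ext; simp; tauto
          rw [this]
          exact MeasurableSet.diff ih' hA
        measurableSet_iUnion := fun A hA => by
          rw [Set.iUnion_inter]
          exact MeasurableSet.iUnion hA }
    have hle : 𝒢 ⊔ ⨆ u ∈ Finset.range t, MeasurableSpace.comap (r u) inferInstance ≤ tr := by
      refine sup_le (fun A hA => ?_) (iSup₂_le fun u hu => ?_)
      · exact MeasurableSet.inter (m := m) (le_sup_left (a := 𝒢) A hA) ih'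
      · rintro _ ⟨B, hB, rfl⟩
        have : r u ⁻¹' B ∩ E = y u ⁻¹' B ∩ E := by
          ext ω
          simp only [Set.mem_inter_iff, Set.mem_preimage, and_congr_left_iff]
          intro hω
          have hut := Finset.mem_range.1 hu
          rw [hy u (hut.trans t.lt_succ_self) ω (hω u hut)]
        change MeasurableSet[m] (r u ⁻¹' B ∩ E)
        rw [this]
        refine MeasurableSet.inter (m := m) ?_ ih'
        have : MeasurableSpace.comap (y u) inferInstance ≤ m :=
          le_sup_of_le_right (le_iSup₂_of_le u hu le_rfl)
        exact this _ ⟨B, hB, rfl⟩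
    have h1 : MeasurableSet[m] ({ω | node t ω = p t} ∩ E) := hle _ (hn t t.lt_succ_self (p t))
    have h2 : {ω | ∀ s < t + 1, node s ω = p s} = {ω | node t ω = p t} ∩ E := by
      ext ω
      simp only [hE, Set.mem_ofPred_eq, Set.mem_inter_iff, Nat.lt_succ_iff_lt_or_eq]
      exact ⟨fun h => ⟨h t (.inr rfl), fun s hs => h s (.inl hs)⟩,
        fun h s hs => hs.elim (h.2 s) fun e => e ▸ h.1⟩
    rw [h2]
    have hmono : m ≤ 𝒢 ⊔ ⨆ u ∈ Finset.range (t + 1), MeasurableSpace.comap (y u) inferInstance :=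
      sup_le_sup_left (biSup_mono fun u hu => Finset.range_mono t.le_succ hu) _
    exact hmono _ h1

/-- If `m₁` and `m₂` are independent, and `𝒢` is independent of both jointly, then `m₁` is
independent of `𝒢` and `m₂` jointly. -/
lemma indep_sup_of_indep [mΩ : MeasurableSpace Ω] {P : Measure Ω} [IsProbabilityMeasure P]
    {m₁ m₂ 𝓗 𝒢 : MeasurableSpace Ω} (h1 : m₁ ≤ 𝓗) (h2 : m₂ ≤ 𝓗) (hH : 𝓗 ≤ mΩ) (hG : 𝒢 ≤ mΩ) (hGH : Indep 𝒢 𝓗 P) (h12 : Indep m₁ m₂ P) :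
    Indep m₁ (𝒢 ⊔ m₂) P := by
  let π : Set (Set Ω) := {C | ∃ A B, MeasurableSet[𝒢] A ∧ MeasurableSet[m₂] B ∧ A ∩ B = C}
  have hπ : IsPiSystem π := by
    rintro _ ⟨A, B, hA, hB, rfl⟩ _ ⟨A', B', hA', hB', rfl⟩ -
    exact ⟨A ∩ A', B ∩ B', hA.inter hA', hB.inter hB', Set.inter_inter_inter_comm _ _ _ _⟩
  have hgen : 𝒢 ⊔ m₂ = MeasurableSpace.generateFrom π := by
    refine le_antisymm (sup_le (fun A hA => ?_) fun B hB => ?_)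
      (MeasurableSpace.generateFrom_le ?_)
    · exact MeasurableSpace.measurableSet_generateFrom
        ⟨A, Set.univ, hA, MeasurableSet.univ, by simp⟩
    · exact MeasurableSpace.measurableSet_generateFrom
        ⟨Set.univ, B, MeasurableSet.univ, hB, by simp⟩
    · rintro _ ⟨A, B, hA, hB, rfl⟩
      exact MeasurableSet.inter (le_sup_left (a := 𝒢) (b := m₂) A hA)
        (le_sup_right (a := 𝒢) (b := m₂) B hB)
  refine IndepSets.indep (h1.trans hH) (sup_le hG (h2.trans hH))
    (@MeasurableSpace.isPiSystem_measurableSet Ω m₁) hπ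
    (@MeasurableSpace.generateFrom_measurableSet Ω m₁).symm hgen ?_
  rw [IndepSets_iff]
  rintro C _ hC ⟨A, B, hA, hB, rfl⟩
  have e1 := (Indep_iff 𝒢 𝓗 P).1 hGH A (C ∩ B) hA (MeasurableSet.inter (h1 C hC) (h2 B hB))
  have e2 := (Indep_iff 𝒢 𝓗 P).1 hGH A B hA (h2 B hB)
  have e3 := (Indep_iff m₁ m₂ P).1 h12 C B hC hB
  rw [e2, Set.inter_left_comm, e1, e3]
  ring

end Adaptive

end GPOO

end

noncomputable section

namespace GPOO

open scoped ENNReal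

section Model

variable {D K S : ℕ} {X : Set (Fin D → ℝ)} {Ω : Type*} [mΩ : MeasurableSpace Ω] {P : Measure Ω}

/-- A node of the `K`-ary tree. -/
def IsNode (K : ℕ) (m : ℕ × ℕ) : Prop := m.2 < K ^ m.1

/-- A centred Gaussian process on `X` with covariance `k`, observed with independent Gaussian
noise. -/
structure IsModel (X : Set (Fin D → ℝ)) (k : (Fin D → ℝ) → (Fin D → ℝ) → ℝ) (σ : ℝ)
    (f : (Fin D → ℝ) → Ω → ℝ) (noise : ℕ → Ω → ℝ) (P : Measure Ω) : Prop where
  measurable_f : ∀ x ∈ X, Measurable (f x)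
  gaussian : IsGaussianProcess (fun (x : X) => f x) P
  mean : ∀ x ∈ X, ∫ ω, f x ω ∂P = 0
  cov : ∀ x ∈ X, ∀ y ∈ X, ∫ ω, f x ω * f y ω ∂P = k x y
  measurable_noise : ∀ t, Measurable (noise t)
  law_noise : ∀ t, P.map (noise t) = gaussianReal 0 (Real.toNNReal (σ ^ 2))
  indep_noise : iIndepFun noise P
  indep : Indep (⨆ x ∈ X, MeasurableSpace.comap (f x) inferInstance)
    (⨆ t, MeasurableSpace.comap (noise t) inferInstance) P

/-- The process consisting of the rewards and the noise. -/
def joint (X : Set (Fin D → ℝ)) (f : (Fin D → ℝ) → Ω → ℝ) (noise : ℕ → Ω → ℝ) : X ⊕ ℕ → Ω → ℝ :=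
  Sum.elim (fun (x : X) => f x) noise

/-- The reward observed in round `t` if the node `m` is selected. -/
def obs (T : CellTree D K S X) (f : (Fin D → ℝ) → Ω → ℝ) (noise : ℕ → Ω → ℝ) (m : ℕ × ℕ) (t : ℕ)
    (ω : Ω) : ℝ :=
  avg T (fun x => f x ω) m + noise t ω

namespace IsModel

variable {k : (Fin D → ℝ) → (Fin D → ℝ) → ℝ} {σ : ℝ} {f : (Fin D → ℝ) → Ω → ℝ}
  {noise : ℕ → Ω → ℝ}

lemma hasGaussianLaw_noise (h : IsModel X k σ f noise P) (t : ℕ) : HasGaussianLaw (noise t) P where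
  isGaussian_map := by rw [h.law_noise t]; infer_instance

lemma integral_noise (h : IsModel X k σ f noise P) (t : ℕ) : ∫ ω, noise t ω ∂P = 0 := by
  have : ∫ ω, noise t ω ∂P = ∫ x, x ∂(P.map (noise t)) :=
    (integral_map (h.measurable_noise t).aemeasurable
      measurable_id.aestronglyMeasurable).symm
  rw [this, h.law_noise, integral_id_gaussianReal]

lemma variance_noise (h : IsModel X k σ f noise P) (t : ℕ) : Var[noise t; P] = σ ^ 2 := by
  have : Var[noise t; P] = Var[id; P.map (noise t)] :=
    (variance_id_map (h.measurable_noise t).aemeasurable).symm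
  rw [this, h.law_noise, variance_id_gaussianReal, Real.coe_toNNReal _ (sq_nonneg σ)]

omit mΩ in
lemma measurable_f_sup {x : Fin D → ℝ} (hx : x ∈ X) :
    Measurable[⨆ x ∈ X, MeasurableSpace.comap (f x) inferInstance] (f x) :=
  measurable_iff_comap_le.2 (le_iSup₂_of_le x hx le_rfl)

omit mΩ in
lemma measurable_noise_sup (t : ℕ) :
    Measurable[⨆ t, MeasurableSpace.comap (noise t) inferInstance] (noise t) :=
  measurable_iff_comap_le.2 (le_iSup_of_le t le_rfl)

lemma isGaussianProcess_joint (h : IsModel X k σ f noise P) :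
    IsGaussianProcess (joint X f noise) P := by
  have hn : IsGaussianProcess noise P := ⟨fun I =>
    (h.indep_noise.precomp (g := fun i : I => (i : ℕ)) Subtype.val_injective).hasGaussianLaw
      fun i => h.hasGaussianLaw_noise i⟩
  refine isGaussianProcess_sumElim h.gaussian hn fun I J => ?_
  rw [IndepFun_iff_Indep]
  refine indep_of_indep_of_le_left (indep_of_indep_of_le_right h.indep ?_) ?_
  · refine measurable_iff_comap_le.1 ?_
    exact @measurable_pi_lambda _ _ _ (_) _ _ fun i => measurable_noise_sup (i : ℕ)
  · refine measurable_iff_comap_le.1 ?_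
    exact @measurable_pi_lambda _ _ _ (_) _ _ fun i => measurable_f_sup i.1.2

lemma integral_joint (h : IsModel X k σ f noise P) (i : X ⊕ ℕ) :
    ∫ ω, joint X f noise i ω ∂P = 0 := by
  cases i with
  | inl x => exact h.mean x x.2
  | inr t => exact h.integral_noise t

lemma memLp_f (h : IsModel X k σ f noise P) {x : Fin D → ℝ} (hx : x ∈ X) : MemLp (f x) 2 P :=
  (h.gaussian.hasGaussianLaw_eval ⟨x, hx⟩).memLp_two

lemma memLp_noise (h : IsModel X k σ f noise P) (t : ℕ) : MemLp (noise t) 2 P :=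
  (h.hasGaussianLaw_noise t).memLp_two

lemma covariance_f [IsProbabilityMeasure P] (h : IsModel X k σ f noise P) {x y : Fin D → ℝ}
    (hx : x ∈ X) (hy : y ∈ X) : cov[f x, f y; P] = k x y := by
  rw [covariance_eq_sub (h.memLp_f hx) (h.memLp_f hy), h.mean x hx, h.mean y hy, mul_zero, sub_zero]
  exact h.cov x hx y hy

lemma covariance_f_noise (h : IsModel X k σ f noise P) {x : Fin D → ℝ}
    (hx : x ∈ X) (t : ℕ) : cov[f x, noise t; P] = 0 := by
  refine IndepFun.covariance_eq_zero ?_ (h.memLp_f hx) (h.memLp_noise t)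
  rw [IndepFun_iff_Indep]
  exact indep_of_indep_of_le_left (indep_of_indep_of_le_right h.indep
    (measurable_iff_comap_le.1 (measurable_noise_sup t)))
    (measurable_iff_comap_le.1 (measurable_f_sup hx))

lemma covariance_noise (h : IsModel X k σ f noise P) (s t : ℕ) :
    cov[noise s, noise t; P] = if s = t then σ ^ 2 else 0 := by
  split_ifs with hst
  · rw [hst, covariance_self (h.measurable_noise t).aemeasurable, h.variance_noise]
  · exact (h.indep_noise.indepFun hst).covariance_eq_zero (h.memLp_noise s) (h.memLp_noise t)

end IsModel

namespace CellTree

lemma cell_subset_parent (hK : 1 ≤ K) (T : CellTree D K S X) {h i : ℕ} (hi : i < K ^ (h + 1)) :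
    T.cell (h + 1, i) ⊆ T.cell (h, i / K) := by
  have hi' : i / K < K ^ h := Nat.div_lt_of_lt_mul (by rwa [pow_succ'] at hi)
  rw [T.cell_split h _ hi']
  refine Set.subset_iUnion_of_subset ⟨i % K, Nat.mod_lt _ hK⟩ ?_
  rw [show K * (i / K) + i % K = i from Nat.div_add_mod i K]

lemma cell_subset (hK : 1 ≤ K) (T : CellTree D K S X) {m : ℕ × ℕ} (hm : IsNode K m) :
    T.cell m ⊆ X := by
  obtain ⟨h, i⟩ := m
  induction h generalizing i with
  | zero =>
    have : i = 0 := by simpa [IsNode] using hm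
    rw [this, T.cell_root]
  | succ h ih =>
    exact (T.cell_subset_parent hK hm).trans
      (ih (i / K) (Nat.div_lt_of_lt_mul (by rwa [← pow_succ'])))

lemma rep_mem' (hK : 1 ≤ K) (T : CellTree D K S X) {m : ℕ × ℕ} (hm : IsNode K m) (s : Fin S) :
    T.rep m s ∈ X :=
  T.cell_subset hK hm (T.rep_mem m.1 m.2 hm s)

end CellTree

namespace IsModel

variable {k : (Fin D → ℝ) → (Fin D → ℝ) → ℝ} {σ : ℝ} {f : (Fin D → ℝ) → Ω → ℝ}
  {noise : ℕ → Ω → ℝ} {T : CellTree D K S X}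

omit mΩ in
lemma avg_mem_span (hK : 1 ≤ K) {m : ℕ × ℕ} (hm : IsNode K m) :
    (fun ω => avg T (fun x => f x ω) m) ∈ Submodule.span ℝ (Set.range (joint X f noise)) := by
  have e : (fun ω => avg T (fun x => f x ω) m) =
      (1 / (S : ℝ)) • ∑ s, joint X f noise (.inl ⟨T.rep m s, T.rep_mem' hK hm s⟩) := by
    ext ω; simp [avg, joint, Finset.sum_apply]
  rw [e]
  exact Submodule.smul_mem _ _ (Submodule.sum_mem _ fun s _ => Submodule.subset_span ⟨_, rfl⟩)

omit mΩ in
lemma obs_mem_span (hK : 1 ≤ K) {m : ℕ × ℕ} (hm : IsNode K m) (t : ℕ) :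
    obs T f noise m t ∈ Submodule.span ℝ (Set.range (joint X f noise)) :=
  Submodule.add_mem _ (avg_mem_span hK hm) (Submodule.subset_span ⟨.inr t, rfl⟩)

lemma memLp_avg (h : IsModel X k σ f noise P) (hK : 1 ≤ K) {m : ℕ × ℕ} (hm : IsNode K m) :
    MemLp (fun ω => avg T (fun x => f x ω) m) 2 P :=
  (hasGaussianLaw_of_mem_span h.isGaussianProcess_joint (avg_mem_span hK hm)).memLp_two

lemma memLp_obs (h : IsModel X k σ f noise P) (hK : 1 ≤ K) {m : ℕ × ℕ} (hm : IsNode K m) (t : ℕ) :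
    MemLp (obs T f noise m t) 2 P :=
  (h.memLp_avg hK hm).add (h.memLp_noise t)

lemma covariance_avg [IsProbabilityMeasure P] (h : IsModel X k σ f noise P) (hK : 1 ≤ K)
    {m m' : ℕ × ℕ} (hm : IsNode K m) (hm' : IsNode K m') :
    cov[fun ω => avg T (fun x => f x ω) m, fun ω => avg T (fun x => f x ω) m'; P] =
      avg T (fun x => avg T (k x) m') m := by
  simp only [avg]
  rw [covariance_const_mul_left, covariance_const_mul_right, covariance_fun_sum_fun_sum
    (fun s => h.memLp_f (T.rep_mem' hK hm s)) (fun s => h.memLp_f (T.rep_mem' hK hm' s))]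
  simp only [h.covariance_f (T.rep_mem' hK hm _) (T.rep_mem' hK hm' _), Finset.mul_sum]

lemma covariance_avg_noise [IsProbabilityMeasure P] (h : IsModel X k σ f noise P) (hK : 1 ≤ K)
    {m : ℕ × ℕ} (hm : IsNode K m) (t : ℕ) :
    cov[fun ω => avg T (fun x => f x ω) m, noise t; P] = 0 := by
  simp only [avg]
  rw [covariance_const_mul_left, covariance_fun_sum_left
    (fun s => h.memLp_f (T.rep_mem' hK hm s)) (h.memLp_noise t)]
  simp [h.covariance_f_noise (T.rep_mem' hK hm _)]

lemma covariance_avg_obs [IsProbabilityMeasure P] (h : IsModel X k σ f noise P) (hK : 1 ≤ K)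
    {m m' : ℕ × ℕ} (hm : IsNode K m) (hm' : IsNode K m') (t : ℕ) :
    cov[fun ω => avg T (fun x => f x ω) m, obs T f noise m' t; P] =
      avg T (fun x => avg T (k x) m') m := by
  have e : obs T f noise m' t = (fun ω => avg T (fun x => f x ω) m') + noise t := rfl
  rw [e, covariance_add_right (h.memLp_avg hK hm) (h.memLp_avg hK hm') (h.memLp_noise t),
    h.covariance_avg hK hm hm', h.covariance_avg_noise hK hm, add_zero]

lemma covariance_obs [IsProbabilityMeasure P] (h : IsModel X k σ f noise P) (hK : 1 ≤ K)
    {m m' : ℕ × ℕ} (hm : IsNode K m) (hm' : IsNode K m') (t t' : ℕ) :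
    cov[obs T f noise m t, obs T f noise m' t'; P] =
      avg T (fun x => avg T (k x) m') m + if t = t' then σ ^ 2 else 0 := by
  have e : obs T f noise m t = (fun ω => avg T (fun x => f x ω) m) + noise t := rfl
  have e' : obs T f noise m' t' = (fun ω => avg T (fun x => f x ω) m') + noise t' := rfl
  rw [e, covariance_add_left (h.memLp_avg hK hm) (h.memLp_noise t) (h.memLp_obs hK hm' t'),
    h.covariance_avg_obs hK hm hm', e', covariance_add_right (h.memLp_noise t)
      (h.memLp_avg hK hm') (h.memLp_noise t'), covariance_comm (noise t),
    h.covariance_avg_noise hK hm', h.covariance_noise, zero_add]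

variable {n : ℕ} {past : Fin n → ℕ × ℕ} {m : ℕ × ℕ}

lemma isUnit_det_obsCov [IsProbabilityMeasure P] (h : IsModel X k σ f noise P) (hσ : 0 < σ)
    (hK : 1 ≤ K) (hpast : ∀ i, IsNode K (past i)) : IsUnit (obsCov T k σ past).det := by
  let F : Fin n → Ω → ℝ := fun i ω => avg T (fun x => f x ω) (past i)
  have hF : ∀ i, MemLp (F i) 2 P := fun i => h.memLp_avg hK (hpast i)
  have hpsd : (Matrix.of fun i j => avg T (fun x => avg T (k x) (past j)) (past i)
      : Matrix (Fin n) (Fin n) ℝ).PosSemidef := by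
    have e : ∀ i j, avg T (fun x => avg T (k x) (past j)) (past i) = cov[F i, F j; P] :=
      fun i j => (h.covariance_avg hK (hpast i) (hpast j)).symm
    refine Matrix.PosSemidef.of_dotProduct_mulVec_nonneg ?_ fun x => ?_
    · ext i j
      simp only [Matrix.conjTranspose_apply, Matrix.of_apply, star_trivial, e]
      exact covariance_comm _ _
    · have hv := variance_nonneg (fun ω => ∑ i, x i * F i ω) P
      have hm := memLp_lincomb hF x
      rw [← covariance_self hm.aemeasurable, covariance_fun_sum_fun_sum
        (fun i => (hF i).const_mul (x i)) (fun i => (hF i).const_mul (x i))] at hv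
      simp only [covariance_const_mul_left, covariance_const_mul_right, ← e] at hv
      simpa [dotProduct, Matrix.mulVec, Finset.mul_sum, mul_comm, mul_left_comm] using hv
  have hpd : (obsCov T k σ past).PosDef :=
    Matrix.PosDef.posSemidef_add hpsd (Matrix.PosDef.one.smul (by positivity))
  exact (Matrix.isUnit_iff_isUnit_det _).1 hpd.isUnit

/-- The weights of the posterior mean of a node. -/
def weights (T : CellTree D K S X) (k : (Fin D → ℝ) → (Fin D → ℝ) → ℝ) (σ : ℝ)
    (past : Fin n → ℕ × ℕ) (m : ℕ × ℕ) : Fin n → ℝ :=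
  (fun j => avg T (fun x => avg T (k x) (past j)) m) ᵥ* (obsCov T k σ past)⁻¹

lemma weights_vecMul [IsProbabilityMeasure P] (h : IsModel X k σ f noise P) (hσ : 0 < σ)
    (hK : 1 ≤ K) (hpast : ∀ i, IsNode K (past i)) :
    weights T k σ past m ᵥ* obsCov T k σ past =
      fun j => avg T (fun x => avg T (k x) (past j)) m := by
  rw [weights, Matrix.vecMul_vecMul, Matrix.nonsing_inv_mul _ (h.isUnit_det_obsCov hσ hK hpast),
    Matrix.vecMul_one]

lemma avg_dotProduct (T : CellTree D K S X) (u : (Fin D → ℝ) → Fin n → ℝ) (v : Fin n → ℝ) :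
    avg T (fun x => u x ⬝ᵥ v) m = (fun j => avg T (fun x => u x j) m) ⬝ᵥ v := by
  simp only [avg, dotProduct, Finset.mul_sum, Finset.sum_mul]
  rw [Finset.sum_comm]
  simp only [mul_assoc]

lemma avg_postMean (T : CellTree D K S X) (y : Fin n → ℝ) :
    avg T (postMean T k σ past y) m = ∑ i, weights T k σ past m i * y i := by
  change avg T (fun x => crossCov T k past x ⬝ᵥ ((obsCov T k σ past)⁻¹ *ᵥ y)) m = _
  rw [avg_dotProduct, Matrix.dotProduct_mulVec]
  rfl

lemma avg_sub (T : CellTree D K S X) (u v : (Fin D → ℝ) → ℝ) :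
    avg T (fun x => u x - v x) m = avg T u m - avg T v m := by
  simp only [avg, Finset.sum_sub_distrib, mul_sub]

lemma avg_postCov (T : CellTree D K S X) :
    avg T (fun x => avg T (postCov T k σ past x) m) m =
      avg T (fun x => avg T (k x) m) m - weights T k σ past m ⬝ᵥ
        fun j => avg T (fun x => avg T (k x) (past j)) m := by
  set q : Fin n → ℝ := fun j => avg T (fun x => avg T (k x) (past j)) m with hq
  have h1 : ∀ x, avg T (postCov T k σ past x) m =
      avg T (k x) m - crossCov T k past x ⬝ᵥ ((obsCov T k σ past)⁻¹ *ᵥ q) := by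
    intro x
    change avg T (fun x' => k x x' - crossCov T k past x ⬝ᵥ ((obsCov T k σ past)⁻¹ *ᵥ
      crossCov T k past x')) m = _
    rw [avg_sub]
    congr 1
    simp only [Matrix.dotProduct_mulVec]
    simp only [dotProduct_comm (crossCov T k past x ᵥ* _)]
    rw [avg_dotProduct]
    rfl
  simp only [h1]
  rw [avg_sub, avg_dotProduct, Matrix.dotProduct_mulVec]
  rfl

/-- Difference between the value of a node and its posterior mean. -/
def residual (T : CellTree D K S X) (k : (Fin D → ℝ) → (Fin D → ℝ) → ℝ) (σ : ℝ)
    (f : (Fin D → ℝ) → Ω → ℝ) (past : Fin n → ℕ × ℕ) (y : Fin n → Ω → ℝ) (m : ℕ × ℕ) (ω : Ω) : ℝ :=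
  avg T (fun x => f x ω) m - ∑ i, weights T k σ past m i * y i ω

/-- The noisy observations at prescribed nodes. -/
def obsVec (T : CellTree D K S X) (f : (Fin D → ℝ) → Ω → ℝ) (noise : ℕ → Ω → ℝ)
    (past : Fin n → ℕ × ℕ) (i : Fin n) : Ω → ℝ := obs T f noise (past i) i

lemma covariance_obsVec [IsProbabilityMeasure P] (h : IsModel X k σ f noise P)
    (hK : 1 ≤ K) (hpast : ∀ i, IsNode K (past i)) (i j : Fin n) :
    cov[obsVec T f noise past i, obsVec T f noise past j; P] = obsCov T k σ past i j := by
  rw [obsVec, obsVec, h.covariance_obs hK (hpast i) (hpast j)]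
  simp [obsCov, Matrix.one_apply, Fin.ext_iff]

lemma memLp_obsVec (h : IsModel X k σ f noise P)
    (hK : 1 ≤ K) (hpast : ∀ i, IsNode K (past i)) (i : Fin n) :
    MemLp (obsVec T f noise past i) 2 P := h.memLp_obs hK (hpast i) _

lemma variance_residual_eq [IsProbabilityMeasure P] (h : IsModel X k σ f noise P) (hσ : 0 < σ)
    (hK : 1 ≤ K) (hpast : ∀ i, IsNode K (past i)) (hm : IsNode K m) :
    Var[residual T k σ f past (obsVec T f noise past) m; P] =
      avg T (fun x => avg T (postCov T k σ past x) m) m := by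
  rw [avg_postCov, ← h.covariance_avg hK hm hm, covariance_self (h.memLp_avg hK hm).aemeasurable]
  exact variance_residual (h.memLp_avg hK hm) (h.memLp_obsVec hK hpast)
    (h.covariance_obsVec hK hpast) (fun j => h.covariance_avg_obs hK hm (hpast j) _)
    (h.weights_vecMul hσ hK hpast)

omit mΩ in
lemma residual_mem_span (hK : 1 ≤ K) (hpast : ∀ i, IsNode K (past i)) (hm : IsNode K m) :
    residual T k σ f past (obsVec T f noise past) m ∈
      Submodule.span ℝ (Set.range (joint X f noise)) := by
  have e : residual T k σ f past (obsVec T f noise past) m =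
      (fun ω => avg T (fun x => f x ω) m) -
        ∑ i, weights T k σ past m i • obsVec T f noise past i := by
    ext ω; simp [residual, Finset.sum_apply]
  rw [e]
  exact Submodule.sub_mem _ (avg_mem_span hK hm)
    (Submodule.sum_mem _ fun i _ => Submodule.smul_mem _ _ (obs_mem_span hK (hpast i) _))

lemma indepFun_residual [IsProbabilityMeasure P] (h : IsModel X k σ f noise P) (hσ : 0 < σ)
    (hK : 1 ≤ K) (hpast : ∀ i, IsNode K (past i)) (hm : IsNode K m) :
    IndepFun (residual T k σ f past (obsVec T f noise past) m)
      (fun ω i => obsVec T f noise past i ω) P := by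
  have hr := residual_mem_span (T := T) (k := k) (σ := σ) (f := f) (noise := noise) hK hpast hm
  have hG : IsGaussianProcess
      (Sum.elim (fun _ : Unit => residual T k σ f past (obsVec T f noise past) m)
        (obsVec T f noise past)) P := by
    refine isGaussianProcess_of_mem_span h.isGaussianProcess_joint ?_
    rintro (_ | i)
    · exact hr
    · exact obs_mem_span hK (hpast i) _
  have hind := hG.indepFun_of_covariance_eq_zero
    (fun _ => (hasGaussianLaw_of_mem_span h.isGaussianProcess_joint hr).aemeasurable)
    (fun i => (h.memLp_obsVec hK hpast i).aemeasurable)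
    fun _ j => covariance_residual_eq_zero (h.memLp_avg hK hm) (h.memLp_obsVec hK hpast)
      (h.covariance_obsVec hK hpast) (fun j => h.covariance_avg_obs hK hm (hpast j) _)
      (h.weights_vecMul hσ hK hpast) j
  exact hind.comp (φ := fun v : Unit → ℝ => v ()) (ψ := id) (by fun_prop) measurable_id

/-- Observing a node repeatedly reduces its posterior variance. -/
lemma avg_postCov_le [IsProbabilityMeasure P] (h : IsModel X k σ f noise P) (hσ : 0 < σ)
    (hK : 1 ≤ K) (hpast : ∀ i, IsNode K (past i)) (hm : IsNode K m) {I : Finset (Fin n)}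
    (hI : I.Nonempty) (hIm : ∀ i ∈ I, past i = m) :
    avg T (fun x => avg T (postCov T k σ past x) m) m ≤ σ ^ 2 / I.card := by
  classical
  have hc : (I.card : ℝ) ≠ 0 := by exact_mod_cast hI.card_pos.ne'
  rw [← h.variance_residual_eq hσ hK hpast hm]
  refine (variance_residual_le (h.memLp_avg hK hm) (h.memLp_obsVec hK hpast)
    (h.covariance_obsVec hK hpast) (fun j => h.covariance_avg_obs hK hm (hpast j) _)
    (h.weights_vecMul hσ hK hpast) fun i => if i ∈ I then (I.card : ℝ)⁻¹ else 0).trans ?_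
  have e : (fun ω => avg T (fun x => f x ω) m -
      ∑ i, (if i ∈ I then (I.card : ℝ)⁻¹ else 0) * obsVec T f noise past i ω) =
      fun ω => -(I.card : ℝ)⁻¹ * ∑ i ∈ I, noise i ω := by
    ext ω
    have h1 : ∀ i ∈ I, obsVec T f noise past i ω = avg T (fun x => f x ω) m + noise i ω :=
      fun i hi => by rw [obsVec, obs, hIm i hi]
    simp only [ite_mul, zero_mul, Finset.sum_ite_mem, Finset.univ_inter]
    rw [← Finset.mul_sum, Finset.sum_congr rfl h1, Finset.sum_add_distrib, Finset.sum_const,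
      nsmul_eq_mul]
    field_simp
    ring
  have hsum : MemLp (fun ω => ∑ i ∈ I, noise i ω) 2 P :=
    memLp_finsetSum _ fun i _ => h.memLp_noise i
  rw [e, variance_const_mul, ← covariance_self hsum.aemeasurable,
    covariance_fun_sum_fun_sum' (X := fun i : Fin n => noise i) (Y := fun i : Fin n => noise i)
      (fun i _ => h.memLp_noise i) (fun i _ => h.memLp_noise i)]
  simp only [h.covariance_noise]
  have h2 : ∑ i ∈ I, ∑ j ∈ I, (if (i : ℕ) = j then σ ^ 2 else 0) = I.card * σ ^ 2 := by
    have : ∀ i ∈ I, ∑ j ∈ I, (if (i : ℕ) = j then σ ^ 2 else 0) = σ ^ 2 := by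
      intro i hi
      simp only [← Fin.ext_iff]
      rw [Finset.sum_ite_eq, if_pos hi]
    rw [Finset.sum_congr rfl this, Finset.sum_const, nsmul_eq_mul]
  rw [h2]
  refine le_of_eq ?_
  field_simp

/-- The σ-algebra generated by the rewards and the noise. -/
@[reducible] def sigmaAlg (X : Set (Fin D → ℝ)) (f : (Fin D → ℝ) → Ω → ℝ) (noise : ℕ → Ω → ℝ) :
    MeasurableSpace Ω :=
  (⨆ x ∈ X, MeasurableSpace.comap (f x) inferInstance) ⊔
    (⨆ t, MeasurableSpace.comap (noise t) inferInstance)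

lemma sigmaAlg_le (h : IsModel X k σ f noise P) : sigmaAlg X f noise ≤ mΩ :=
  sup_le (iSup₂_le fun x hx => measurable_iff_comap_le.1 (h.measurable_f x hx))
    (iSup_le fun t => measurable_iff_comap_le.1 (h.measurable_noise t))

omit mΩ in
lemma measurable_avg_sigmaAlg (hK : 1 ≤ K) (hm : IsNode K m) :
    Measurable[sigmaAlg X f noise] fun ω => avg T (fun x => f x ω) m := by
  have h1 : ∀ s, Measurable[sigmaAlg X f noise] (f (T.rep m s)) := fun s =>
    (measurable_f_sup (T.rep_mem' hK hm s)).mono le_sup_left le_rfl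
  let : MeasurableSpace Ω := sigmaAlg X f noise
  exact (Finset.measurable_fun_sum _ fun s _ => h1 s).const_mul _

omit mΩ in
lemma measurable_obs_sigmaAlg (hK : 1 ≤ K) (hm : IsNode K m) (t : ℕ) :
    Measurable[sigmaAlg X f noise] (obs T f noise m t) := by
  have h1 : Measurable[sigmaAlg X f noise] (noise t) :=
    (measurable_noise_sup t).mono le_sup_right le_rfl
  have h2 := measurable_avg_sigmaAlg (T := T) (f := f) (noise := noise) hK hm
  let : MeasurableSpace Ω := sigmaAlg X f noise
  exact h2.add h1

/-- The σ-algebra generated by the noisy observations at prescribed nodes. -/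
@[reducible] def obsAlg (T : CellTree D K S X) (f : (Fin D → ℝ) → Ω → ℝ) (noise : ℕ → Ω → ℝ)
    (past : Fin n → ℕ × ℕ) : MeasurableSpace Ω :=
  MeasurableSpace.comap (fun ω i => obsVec T f noise past i ω) inferInstance

omit mΩ in
lemma obsAlg_le (hK : 1 ≤ K) (hpast : ∀ i, IsNode K (past i)) :
    obsAlg T f noise past ≤ sigmaAlg X f noise := by
  refine measurable_iff_comap_le.1 ?_
  exact @measurable_pi_lambda _ _ _ (_) _ _ fun i => measurable_obs_sigmaAlg hK (hpast i) i

omit mΩ in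
lemma measurable_residual_sigmaAlg (hK : 1 ≤ K) (hpast : ∀ i, IsNode K (past i))
    (hm : IsNode K m) :
    Measurable[sigmaAlg X f noise] (residual T k σ f past (obsVec T f noise past) m) := by
  have h1 : ∀ i, Measurable[sigmaAlg X f noise] (obsVec T f noise past i) :=
    fun i => measurable_obs_sigmaAlg hK (hpast i) _
  have h2 := measurable_avg_sigmaAlg (T := T) (f := f) (noise := noise) hK hm
  let : MeasurableSpace Ω := sigmaAlg X f noise
  exact h2.sub (Finset.measurable_fun_sum _ fun i _ => (h1 i).const_mul _)

end IsModel

end Model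

end GPOO

end

noncomputable section

namespace GPOO

open scoped ENNReal

section Beta

variable {K hmax : ℕ} {θ : ℝ}

/-- The number of nodes up to depth `hmax`. -/
def numNodes (K hmax : ℕ) : ℝ := ∑ h ∈ Finset.range (hmax + 1), (K : ℝ) ^ h

lemma one_le_numNodes (K hmax : ℕ) : 1 ≤ numNodes K hmax := by
  unfold numNodes
  rw [Finset.sum_range_succ']
  simp only [pow_zero]
  have : 0 ≤ ∑ h ∈ Finset.range hmax, (K : ℝ) ^ (h + 1) :=
    Finset.sum_nonneg fun _ _ => by positivity
  linarith

lemma beta_eq (t : ℕ) : beta K hmax θ t =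
    2 * Real.log (numNodes K hmax * (Real.pi ^ 2 * (t : ℝ) ^ 2 / 6) / θ) := rfl

lemma le_beta (hθ : 0 < θ) (hθ1 : θ < 1) {t : ℕ} (ht : 1 ≤ t) :
    2 * Real.log (3 / 2) ≤ beta K hmax θ t := by
  rw [beta_eq]
  have ht' : (1 : ℝ) ≤ t := by exact_mod_cast ht
  have hM := one_le_numNodes K hmax
  have hπ : (9 : ℝ) ≤ Real.pi ^ 2 := by nlinarith [Real.pi_gt_three]
  have h1 : (3 / 2 : ℝ) ≤ Real.pi ^ 2 * (t : ℝ) ^ 2 / 6 := by nlinarith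
  have h2 : 3 / 2 ≤ numNodes K hmax * (Real.pi ^ 2 * (t : ℝ) ^ 2 / 6) / θ := by
    rw [le_div_iff₀ hθ]
    nlinarith
  exact mul_le_mul_of_nonneg_left (Real.log_le_log (by norm_num) h2) two_pos.le

lemma log_three_halves_pos : 0 < Real.log (3 / 2) := Real.log_pos (by norm_num)

lemma beta_pos (hθ : 0 < θ) (hθ1 : θ < 1) {t : ℕ} (ht : 1 ≤ t) : 0 < beta K hmax θ t :=
  (mul_pos two_pos log_three_halves_pos).trans_le (le_beta hθ hθ1 ht)

lemma beta_mono (hθ : 0 < θ) {s t : ℕ} (hs : 1 ≤ s) (hst : s ≤ t) :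
    beta K hmax θ s ≤ beta K hmax θ t := by
  rw [beta_eq, beta_eq]
  have hM := one_le_numNodes K hmax
  have hs' : (0 : ℝ) < s := by exact_mod_cast hs
  gcongr

lemma exp_neg_beta (hθ : 0 < θ) {t : ℕ} (ht : 1 ≤ t) :
    Real.exp (-(beta K hmax θ t / 2)) =
      θ / numNodes K hmax * (6 / Real.pi ^ 2) * (1 / (t : ℝ) ^ 2) := by
  have hM : 0 < numNodes K hmax := zero_lt_one.trans_le (one_le_numNodes K hmax)
  have ht' : (0 : ℝ) < t := by exact_mod_cast ht
  have hπ := Real.pi_pos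
  rw [beta_eq, mul_div_cancel_left₀ _ two_ne_zero, Real.exp_neg, Real.exp_log (by positivity)]
  field_simp

lemma sum_exp_neg_beta_le (hθ : 0 < θ) (N : ℕ) :
    ∑ t ∈ Finset.range N, numNodes K hmax * Real.exp (-(beta K hmax θ (t + 1) / 2)) ≤ θ := by
  have hM : 0 < numNodes K hmax := zero_lt_one.trans_le (one_le_numNodes K hmax)
  have hπ := Real.pi_pos
  have h1 : ∀ t ∈ Finset.range N, numNodes K hmax * Real.exp (-(beta K hmax θ (t + 1) / 2)) =
      θ * (6 / Real.pi ^ 2) * (1 / ((t + 1 : ℕ) : ℝ) ^ 2) := by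
    intro t _
    rw [exp_neg_beta hθ (Nat.le_add_left 1 t)]
    field_simp
  rw [Finset.sum_congr rfl h1, ← Finset.mul_sum]
  have h2 : ∑ t ∈ Finset.range N, 1 / ((t + 1 : ℕ) : ℝ) ^ 2 ≤ Real.pi ^ 2 / 6 := by
    have h3 := sum_le_hasSum (Finset.range (N + 1)) (fun i _ => by positivity) hasSum_zeta_two
    rw [Finset.sum_range_succ'] at h3
    simpa using h3
  calc _ ≤ θ * (6 / Real.pi ^ 2) * (Real.pi ^ 2 / 6) := by gcongr
    _ = θ := by field_simp

end Beta

section Confidence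

variable {D K S : ℕ} {X : Set (Fin D → ℝ)} {Ω : Type*} {𝒢 : MeasurableSpace Ω}
  [mΩ : MeasurableSpace Ω] {P : Measure Ω}
  [IsProbabilityMeasure P]
  {k : (Fin D → ℝ) → (Fin D → ℝ) → ℝ} {σ : ℝ} {f : (Fin D → ℝ) → Ω → ℝ}
  {noise : ℕ → Ω → ℝ} {T : CellTree D K S X} {N : ℕ}
  {node : ℕ → Ω → ℕ × ℕ} {r : ℕ → Ω → ℝ} {hmax : ℕ} {θ : ℝ}

/-- The confidence interval of the node `m` at time `t` does not contain its value. -/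
def ConfidenceFails (T : CellTree D K S X) (k : (Fin D → ℝ) → (Fin D → ℝ) → ℝ) (σ : ℝ) (hmax : ℕ)
    (θ : ℝ) (g : (Fin D → ℝ) → ℝ) (node : ℕ → ℕ × ℕ) (r : ℕ → ℝ) (t : ℕ) (m : ℕ × ℕ) : Prop :=
  ciWidth T k σ hmax θ node t m <
    |avg T g m - avg T (postMean T k σ (fun s : Fin t => node s) (fun s : Fin t => r s)) m|

/-- Confidence for a node at a fixed time, on the event that a given sequence of nodes has been
selected. -/
lemma measure_forall_eq_and_lt_residual_le (h : IsModel X k σ f noise P) (hσ : 0 < σ) (hK : 1 ≤ K)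
    (h𝒢 : 𝒢 ≤ mΩ) (h𝒢i : Indep 𝒢 (IsModel.sigmaAlg X f noise) P)
    (hr : ∀ t ω, r t ω = avg T (fun x => f x ω) (node t ω) + noise t ω)
    (hn : ∀ t < N, ∀ m, MeasurableSet[𝒢 ⊔ ⨆ s ∈ Finset.range t,
      MeasurableSpace.comap (r s) inferInstance] {ω | node t ω = m})
    {t : ℕ} (ht : t ≤ N) {m : ℕ × ℕ} (hm : IsNode K m) {p : ℕ → ℕ × ℕ}
    (hp : ∀ s < t, IsNode K (p s)) {β : ℝ} (hβ : 0 ≤ β) :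
    MeasurableSet {ω | ∀ s < t, node s ω = p s} ∧
    P ({ω | √β * √(avg T (fun x => avg T (postCov T k σ (fun s : Fin t => p s) x) m) m) <
        |IsModel.residual T k σ f (fun s : Fin t => p s)
          (IsModel.obsVec T f noise fun s : Fin t => p s) m ω|} ∩ {ω | ∀ s < t, node s ω = p s}) ≤
      .ofReal (Real.exp (-(β / 2))) * P {ω | ∀ s < t, node s ω = p s} := by
  set past : Fin t → ℕ × ℕ := fun s => p s
  have hpast : ∀ i, IsNode K (past i) := fun i => hp i i.2
  set W := IsModel.residual T k σ f past (IsModel.obsVec T f noise past) m with hW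
  have hWm := IsModel.measurable_residual_sigmaAlg (T := T) (k := k) (σ := σ) (f := f)
    (noise := noise) hK hpast hm
  have hm₂ := IsModel.obsAlg_le (T := T) (f := f) (noise := noise) hK hpast
  have hind := indep_sup_of_indep (measurable_iff_comap_le.1 hWm) hm₂ h.sigmaAlg_le h𝒢 h𝒢i
    ((IndepFun_iff_Indep _ _ _).1 (h.indepFun_residual hσ hK hpast hm))
  have hE : MeasurableSet[𝒢 ⊔ IsModel.obsAlg T f noise past] {ω | ∀ s < t, node s ω = p s} := by
    have h1 := measurableSet_forall_eq (𝒢 := 𝒢) (node := node) (r := r)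
      (y := fun s => obs T f noise (p s) s) (p := p) t
      (fun s _ ω hs => by rw [hr, hs, obs]) fun s hs => hn s (hs.trans_le ht)
    refine sup_le_sup_left (iSup₂_le fun s hs => ?_) 𝒢 _ h1
    have hs' := Finset.mem_range.1 hs
    rintro _ ⟨B, hB, rfl⟩
    exact ⟨(fun v : Fin t → ℝ => v ⟨s, hs'⟩) ⁻¹' B, measurable_pi_apply _ hB, rfl⟩
  have hWset : MeasurableSet[MeasurableSpace.comap W inferInstance]
      {ω | √β * √(avg T (fun x => avg T (postCov T k σ past x) m) m) < |W ω|} :=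
    ⟨{z | √β * √(avg T (fun x => avg T (postCov T k σ past x) m) m) < |z|},
      measurableSet_lt (by fun_prop) (by fun_prop), rfl⟩
  refine ⟨sup_le h𝒢 (hm₂.trans h.sigmaAlg_le) _ hE, ?_⟩
  rw [(Indep_iff _ _ _).1 hind _ _ hWset hE]
  gcongr
  have hspan := IsModel.residual_mem_span (T := T) (k := k) (σ := σ) (f := f) (noise := noise)
    hK hpast hm
  have hres := measure_sqrt_lt_abs_le (hasGaussianLaw_of_mem_span h.isGaussianProcess_joint hspan)
    (integral_eq_zero_of_mem_span h.isGaussianProcess_joint h.integral_joint hspan) hβ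
  rwa [h.variance_residual_eq hσ hK hpast hm] at hres

/-- Confidence for a node at a fixed time. -/
lemma measure_confidenceFails_le (h : IsModel X k σ f noise P) (hσ : 0 < σ) (hK : 1 ≤ K)
    (h𝒢 : 𝒢 ≤ mΩ) (h𝒢i : Indep 𝒢 (IsModel.sigmaAlg X f noise) P)
    (hr : ∀ t ω, r t ω = avg T (fun x => f x ω) (node t ω) + noise t ω)
    (hn : ∀ t < N, ∀ m, MeasurableSet[𝒢 ⊔ ⨆ s ∈ Finset.range t,
      MeasurableSpace.comap (r s) inferInstance] {ω | node t ω = m})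
    (hnode : ∀ t < N, ∀ ω, IsNode K (node t ω)) (hθ : 0 < θ) (hθ1 : θ < 1)
    {t : ℕ} (ht : t ≤ N) {m : ℕ × ℕ} (hm : IsNode K m) :
    P {ω | ConfidenceFails T k σ hmax θ (fun x => f x ω) (fun s => node s ω) (fun s => r s ω) t m} ≤
      .ofReal (Real.exp (-(beta K hmax θ (t + 1) / 2))) := by
  let ext : (Fin t → ℕ × ℕ) → ℕ → ℕ × ℕ := fun p s => if hs : s < t then p ⟨s, hs⟩ else (0, 0)
  have hext : ∀ (p : Fin t → ℕ × ℕ) (s : Fin t), ext p s = p s := fun p s => by simp [ext, s.2]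
  let E : (Fin t → ℕ × ℕ) → Set Ω := fun p => {ω | ∀ s < t, node s ω = ext p s}
  have hEp : ∀ p, ∀ ω ∈ E p, (fun s : Fin t => node s ω) = p := fun p ω hω =>
    funext fun s => (hω s s.2).trans (hext p s)
  let B : Set Ω := {ω | ConfidenceFails T k σ hmax θ (fun x => f x ω) (fun s => node s ω)
    (fun s => r s ω) t m}
  have hβ : 0 ≤ beta K hmax θ (t + 1) := (beta_pos hθ hθ1 (Nat.le_add_left 1 t)).le
  have key : ∀ p, MeasurableSet (E p) ∧
      P (B ∩ E p) ≤ .ofReal (Real.exp (-(beta K hmax θ (t + 1) / 2))) * P (E p) := by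
    intro p
    by_cases hp : ∀ s, IsNode K (p s)
    · have hmain := measure_forall_eq_and_lt_residual_le h hσ hK h𝒢 h𝒢i hr hn ht hm (p := ext p)
        (fun s hs => (hext p ⟨s, hs⟩) ▸ hp ⟨s, hs⟩) hβ
      refine ⟨hmain.1, (measure_mono ?_).trans hmain.2⟩
      rintro ω ⟨hB, hω⟩
      refine ⟨?_, hω⟩
      have e1 : (fun s : Fin t => ext p s) = p := funext (hext p)
      have e2 := hEp p ω hω
      have e3 : ∀ s : Fin t, r s ω = IsModel.obsVec T f noise p s ω := by
        intro s
        rw [hr, IsModel.obsVec, obs, ← congrFun e2 s]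
      simp only [B, ConfidenceFails, ciWidth, Set.mem_ofPred_eq, e2, e3, IsModel.avg_postMean] at hB
      simp only [Set.mem_ofPred_eq, e1]
      exact hB
    · have hempty : E p = ∅ := by
        refine Set.eq_empty_of_forall_notMem fun ω hω => hp fun s => ?_
        rw [← hEp p ω hω]
        exact hnode s (s.2.trans_le ht) ω
      simp [hempty]
  have hdisj : Pairwise (Function.onFun Disjoint E) := fun p p' hpp => Set.disjoint_left.2
    fun ω h1 h2 => hpp ((hEp p ω h1).symm.trans (hEp p' ω h2))
  have hcover : B ⊆ ⋃ p, B ∩ E p := fun ω hω => Set.mem_iUnion.2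
    ⟨fun s => node s ω, hω, fun s hs => by simp [ext, hs]⟩
  calc P B ≤ ∑' p, P (B ∩ E p) := (measure_mono hcover).trans (measure_iUnion_le _)
    _ ≤ ∑' p, .ofReal (Real.exp (-(beta K hmax θ (t + 1) / 2))) * P (E p) :=
        ENNReal.tsum_le_tsum fun p => (key p).2
    _ = .ofReal (Real.exp (-(beta K hmax θ (t + 1) / 2))) * P (⋃ p, E p) := by
        rw [ENNReal.tsum_mul_left, measure_iUnion hdisj fun p => (key p).1]
    _ ≤ .ofReal (Real.exp (-(beta K hmax θ (t + 1) / 2))) * 1 := by gcongr; exact prob_le_one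
    _ = _ := mul_one _

/-- All confidence intervals are valid with probability at least `1 - θ`. -/
lemma measure_exists_confidenceFails_le (h : IsModel X k σ f noise P) (hσ : 0 < σ) (hK : 1 ≤ K)
    (h𝒢 : 𝒢 ≤ mΩ) (h𝒢i : Indep 𝒢 (IsModel.sigmaAlg X f noise) P)
    (hr : ∀ t ω, r t ω = avg T (fun x => f x ω) (node t ω) + noise t ω)
    (hn : ∀ t < N, ∀ m, MeasurableSet[𝒢 ⊔ ⨆ s ∈ Finset.range t,
      MeasurableSpace.comap (r s) inferInstance] {ω | node t ω = m})
    (hnode : ∀ t < N, ∀ ω, IsNode K (node t ω)) (hθ : 0 < θ) (hθ1 : θ < 1) :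
    P {ω | ∃ t < N, ∃ m, IsNode K m ∧ m.1 ≤ hmax ∧ ConfidenceFails T k σ hmax θ (fun x => f x ω)
      (fun s => node s ω) (fun s => r s ω) t m} ≤ .ofReal θ := by
  let nodes : Finset (Σ _ : ℕ, ℕ) := (Finset.range (hmax + 1)).sigma fun d => Finset.range (K ^ d)
  have hcard : (nodes.card : ℝ) = numNodes K hmax := by
    simp [nodes, numNodes, Finset.card_sigma]
  let B : ℕ → (Σ _ : ℕ, ℕ) → Set Ω := fun t m => {ω | ConfidenceFails T k σ hmax θ (fun x => f x ω)
      (fun s => node s ω) (fun s => r s ω) t (m.1, m.2)}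
  calc _ ≤ P (⋃ t ∈ Finset.range N, ⋃ m ∈ nodes, B t m) := by
        refine measure_mono ?_
        rintro ω ⟨t, ht, m, hm, hd, hf⟩
        simp only [Set.mem_iUnion]
        refine ⟨t, Finset.mem_range.2 ht, ⟨m.1, m.2⟩, ?_, hf⟩
        exact Finset.mem_sigma.2 ⟨Finset.mem_range.2 (Nat.lt_succ_of_le hd), Finset.mem_range.2 hm⟩
    _ ≤ ∑ t ∈ Finset.range N, ∑ m ∈ nodes, P (B t m) :=
        (measure_biUnion_finset_le _ _).trans
          (Finset.sum_le_sum fun t _ => measure_biUnion_finset_le _ _)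
    _ ≤ ∑ t ∈ Finset.range N, ∑ m ∈ nodes,
          .ofReal (Real.exp (-(beta K hmax θ (t + 1) / 2))) := by
        refine Finset.sum_le_sum fun t ht => Finset.sum_le_sum fun m hm => ?_
        exact measure_confidenceFails_le h hσ hK h𝒢 h𝒢i hr hn hnode hθ hθ1
          (Finset.mem_range.1 ht).le (Finset.mem_range.1 (Finset.mem_sigma.1 hm).2)
    _ = .ofReal (∑ t ∈ Finset.range N,
          numNodes K hmax * Real.exp (-(beta K hmax θ (t + 1) / 2))) := by
        rw [ENNReal.ofReal_sum_of_nonneg fun t _ => mul_nonneg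
          (zero_le_one.trans (one_le_numNodes K hmax)) (Real.exp_pos _).le]
        refine Finset.sum_congr rfl fun t _ => ?_
        rw [Finset.sum_const, nsmul_eq_mul, ← hcard, ENNReal.ofReal_mul (by positivity),
          ENNReal.ofReal_natCast]
    _ ≤ .ofReal θ := ENNReal.ofReal_le_ofReal (sum_exp_neg_beta_le hθ N)

end Confidence

end GPOO

end

noncomputable section

namespace GPOO

section Leaves

variable {D K S : ℕ} {X : Set (Fin D → ℝ)} {T : CellTree D K S X}
  {k : (Fin D → ℝ) → (Fin D → ℝ) → ℝ} {σ : ℝ} {δ : ℕ → ℝ} {hmax : ℕ} {θ : ℝ} {N : ℕ}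
  {node : ℕ → ℕ × ℕ} {m : ℕ × ℕ}

lemma mem_children {e : ℕ × ℕ} : m ∈ children K e ↔ ∃ j < K, (e.1 + 1, K * e.2 + j) = m := by
  simp [children]

lemma children_injective {e e' : ℕ × ℕ} (h : m ∈ children K e) (h' : m ∈ children K e') :
    e = e' := by
  obtain ⟨j, hj, rfl⟩ := mem_children.1 h
  obtain ⟨j', hj', h2⟩ := mem_children.1 h'
  obtain ⟨h3, h4⟩ := Prod.mk.inj h2
  have hK : 0 < K := (Nat.zero_le j).trans_lt hj
  have h5 : (K * e'.2 + j') / K = (K * e.2 + j) / K := by rw [h4]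
  rw [Nat.mul_add_div hK, Nat.mul_add_div hK, Nat.div_eq_of_lt hj, Nat.div_eq_of_lt hj'] at h5
  exact Prod.ext (by omega) (by omega)

lemma IsNode.of_mem_children {e : ℕ × ℕ} (he : IsNode K e) (h : m ∈ children K e) : IsNode K m := by
  obtain ⟨j, hj, rfl⟩ := mem_children.1 h
  have he' : e.2 + 1 ≤ K ^ e.1 := he
  change K * e.2 + j < K ^ (e.1 + 1)
  calc K * e.2 + j < K * (e.2 + 1) := by rw [mul_add, mul_one]; omega
    _ ≤ K * K ^ e.1 := Nat.mul_le_mul_left K he'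
    _ = K ^ (e.1 + 1) := (pow_succ' K e.1).symm

lemma depth_of_mem_children {e : ℕ × ℕ} (h : m ∈ children K e) : m.1 = e.1 + 1 := by
  obtain ⟨j, hj, rfl⟩ := mem_children.1 h
  rfl

/-- In every round a leaf is selected. -/
def SelectsLeaves (T : CellTree D K S X) (k : (Fin D → ℝ) → (Fin D → ℝ) → ℝ) (σ : ℝ) (δ : ℕ → ℝ)
    (hmax : ℕ) (θ : ℝ) (N : ℕ) (node : ℕ → ℕ × ℕ) : Prop :=
  ∀ t < N, node t ∈ leaves T k σ δ hmax θ node t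

lemma IsRun.selectsLeaves {r : ℕ → ℝ} (h : IsRun T k σ δ hmax θ N node r) :
    SelectsLeaves T k σ δ hmax θ N node := fun t ht => (h t ht).1

lemma mem_leaves_succ {t : ℕ} (h : m ∈ leaves T k σ δ hmax θ node (t + 1)) :
    m ∈ leaves T k σ δ hmax θ node t ∧ (Expands T k σ δ hmax θ node t → m ≠ node t) ∨
      Expands T k σ δ hmax θ node t ∧ m ∈ children K (node t) := by
  rw [leaves] at h
  split_ifs at h with he
  · rcases Finset.mem_union.1 h with h | h
    · exact .inl ⟨Finset.mem_of_mem_erase h, fun _ => Finset.ne_of_mem_erase h⟩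
    · exact .inr ⟨he, h⟩
  · exact .inl ⟨h, fun h' => absurd h' he⟩

lemma isNode_of_mem_leaves (hs : SelectsLeaves T k σ δ hmax θ N node) {t : ℕ} (ht : t ≤ N)
    (hm : m ∈ leaves T k σ δ hmax θ node t) : IsNode K m ∧ m.1 ≤ hmax := by
  induction t generalizing m with
  | zero =>
    rw [leaves, Finset.mem_singleton] at hm
    simp [hm, IsNode]
  | succ t ih =>
    rcases mem_leaves_succ hm with h | ⟨he, h⟩
    · exact ih (by omega) h.1
    · have h1 := ih (by omega) (hs t (by omega))
      refine ⟨h1.1.of_mem_children h, ?_⟩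
      rw [depth_of_mem_children h]
      exact he.2

lemma SelectsLeaves.isNode (hs : SelectsLeaves T k σ δ hmax θ N node) {t : ℕ} (ht : t < N) :
    IsNode K (node t) ∧ (node t).1 ≤ hmax := isNode_of_mem_leaves hs ht.le (hs t ht)

lemma exists_mem_leaves (hs : SelectsLeaves T k σ δ hmax θ N node) {t : ℕ} (ht : t ≤ N)
    {x : Fin D → ℝ} (hx : x ∈ X) : ∃ m ∈ leaves T k σ δ hmax θ node t, x ∈ T.cell m := by
  induction t with
  | zero => exact ⟨(0, 0), by simp [leaves], by rwa [T.cell_root]⟩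
  | succ t ih =>
    obtain ⟨m, hm, hxm⟩ := ih (by omega)
    rw [leaves]
    split_ifs with he
    · by_cases hmt : m = node t
      · have h1 := (hs.isNode (t := t) (by omega)).1
        rw [hmt, show node t = ((node t).1, (node t).2) from rfl, T.cell_split _ _ h1] at hxm
        obtain ⟨j, hj⟩ := Set.mem_iUnion.1 hxm
        exact ⟨_, Finset.mem_union_right _ (mem_children.2 ⟨j, j.2, rfl⟩), hj⟩
      · exact ⟨m, Finset.mem_union_left _ (Finset.mem_erase.2 ⟨hmt, hm⟩), hxm⟩
    · exact ⟨m, hm, hxm⟩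

lemma expandedNodes_mono {s t : ℕ} (hst : s ≤ t) :
    expandedNodes T k σ δ hmax θ s node ⊆ expandedNodes T k σ δ hmax θ t node :=
  fun _ ⟨u, hu, h⟩ => ⟨u, hu.trans_le hst, h⟩

lemma exists_parent_of_mem_leaves {t : ℕ} (hm : m ∈ leaves T k σ δ hmax θ node t) :
    m = (0, 0) ∨ ∃ e ∈ expandedNodes T k σ δ hmax θ t node, m ∈ children K e := by
  induction t generalizing m with
  | zero => exact .inl (by simpa [leaves] using hm)
  | succ t ih =>
    rcases mem_leaves_succ hm with h | ⟨he, h⟩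
    · exact (ih h.1).imp id fun ⟨e, he, h⟩ => ⟨e, expandedNodes_mono t.le_succ he, h⟩
    · exact .inr ⟨node t, ⟨t, t.lt_succ_self, he, rfl⟩, h⟩

lemma notMem_expandedNodes_of_mem_leaves (hs : SelectsLeaves T k σ δ hmax θ N node) {t : ℕ}
    (ht : t ≤ N) (hm : m ∈ leaves T k σ δ hmax θ node t) :
    m ∉ expandedNodes T k σ δ hmax θ t node := by
  induction t generalizing m with
  | zero => rintro ⟨s, hs, -⟩; exact absurd hs (Nat.not_lt_zero s)
  | succ t ih =>
    rintro ⟨s, hst, hse, hsm⟩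
    rcases mem_leaves_succ hm with h | ⟨he, h⟩
    · rcases Nat.lt_succ_iff_lt_or_eq.1 hst with hlt | rfl
      · exact ih (by omega) h.1 ⟨s, hlt, hse, hsm⟩
      · exact h.2 hse hsm.symm
    · have hd := depth_of_mem_children h
      rcases Nat.lt_succ_iff_lt_or_eq.1 hst with hlt | rfl
      · have h1 := hs s (by omega)
        rw [hsm] at h1
        rcases exists_parent_of_mem_leaves h1 with h2 | ⟨e, he', h2⟩
        · rw [h2] at hd; simp at hd
        · rw [children_injective h2 h] at he'
          exact ih (by omega) (hs t (by omega)) (expandedNodes_mono hlt.le he')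
      · rw [← hsm] at hd; omega

/-- A node is expanded at most once. -/
lemma eq_of_expands_of_node_eq (hs : SelectsLeaves T k σ δ hmax θ N node) {s t : ℕ} (hsN : s < N)
    (htN : t < N) (hse : Expands T k σ δ hmax θ node s) (hte : Expands T k σ δ hmax θ node t)
    (h : node s = node t) : s = t := by
  rcases lt_trichotomy s t with hlt | rfl | hlt
  · exact absurd ⟨s, hlt, hse, h⟩ (notMem_expandedNodes_of_mem_leaves hs htN.le (hs t htN))
  · rfl
  · exact absurd ⟨t, hlt, hte, h.symm⟩ (notMem_expandedNodes_of_mem_leaves hs hsN.le (hs s hsN))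

lemma CellTree.disjoint_cell (hK : 1 ≤ K) (T : CellTree D K S X) {h i i' : ℕ} (hi : i < K ^ h)
    (hi' : i' < K ^ h) (hne : i ≠ i') : Disjoint (T.cell (h, i)) (T.cell (h, i')) := by
  induction h generalizing i i' with
  | zero => simp at hi hi'; omega
  | succ h ih =>
    have hp : i / K < K ^ h := Nat.div_lt_of_lt_mul (by rwa [pow_succ'] at hi)
    have hp' : i' / K < K ^ h := Nat.div_lt_of_lt_mul (by rwa [pow_succ'] at hi')
    by_cases hq : i / K = i' / K
    · have h1 := T.cell_disjoint h _ hp ⟨i % K, Nat.mod_lt _ hK⟩ ⟨i' % K, Nat.mod_lt _ hK⟩ (by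
        intro he
        have he' : i % K = i' % K := congrArg Fin.val he
        exact hne (by rw [← Nat.div_add_mod i K, ← Nat.div_add_mod i' K, hq, he']))
      simp only [Nat.div_add_mod] at h1
      rwa [hq, Nat.div_add_mod] at h1
    · exact (ih hp hp' hq).mono (T.cell_subset_parent hK hi) (T.cell_subset_parent hK hi')

end Leaves

section Regret

variable {D K S : ℕ} {X : Set (Fin D → ℝ)} {T : CellTree D K S X}
  {k : (Fin D → ℝ) → (Fin D → ℝ) → ℝ} {σ : ℝ} {δ : ℕ → ℝ} {hmax : ℕ} {θ : ℝ} {N : ℕ}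
  {node : ℕ → ℕ × ℕ} {r : ℕ → ℝ} {m : ℕ × ℕ} {g : (Fin D → ℝ) → ℝ} {L ν d C : ℝ}

lemma le_avg (hS : 1 ≤ S) {a : ℝ} (h : ∀ s, a ≤ g (T.rep m s)) : a ≤ avg T g m := by
  have hS' : (0 : ℝ) < S := by exact_mod_cast hS
  rw [avg, one_div, inv_mul_eq_div, le_div_iff₀ hS']
  simpa [mul_comm] using Finset.card_nsmul_le_sum Finset.univ _ a fun s _ => h s

lemma exists_avg_le (hS : 1 ≤ S) : ∃ s, avg T g m ≤ g (T.rep m s) := by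
  by_contra! hcon
  have hS' : (0 : ℝ) < S := by exact_mod_cast hS
  have : Nonempty (Fin S) := ⟨⟨0, hS⟩⟩
  have h1 := Finset.sum_lt_sum_of_nonempty (s := Finset.univ) Finset.univ_nonempty
    fun s _ => hcon s
  rw [Finset.sum_const, Finset.card_univ, Fintype.card_fin, nsmul_eq_mul] at h1
  have h2 : (S : ℝ) * avg T g m = ∑ s, g (T.rep m s) := by
    rw [avg]; field_simp
  linarith

/-- The values of `g` on a cell exceed the value of the node by at most the diameter. -/
lemma sub_le_avg (hK : 1 ≤ K) (hS : 1 ≤ S) (hm : IsNode K m)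
    (hlip : ∀ x ∈ X, ∀ y ∈ X, |g x - g y| ≤ L * l1Dist x y) (hdiam : DiamBound T L δ)
    {y : Fin D → ℝ} (hy : y ∈ T.cell m) : g y - δ m.1 ≤ avg T g m := by
  refine le_avg hS fun s => ?_
  have h1 := hlip _ (T.rep_mem' hK hm s) _ (T.cell_subset hK hm hy)
  have h2 := hdiam m.1 m.2 hm s y hy
  have h3 := neg_le_of_abs_le h1
  linarith

/-- The hypotheses on a run under which the regret is bounded. -/
structure GoodRun (T : CellTree D K S X) (k : (Fin D → ℝ) → (Fin D → ℝ) → ℝ) (σ L : ℝ)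
    (δ : ℕ → ℝ) (hmax : ℕ) (θ : ℝ) (N : ℕ) (node : ℕ → ℕ × ℕ) (r : ℕ → ℝ)
    (g : (Fin D → ℝ) → ℝ) : Prop where
  run : IsRun T k σ δ hmax θ N node r
  conf : ∀ t < N, ∀ m, IsNode K m → m.1 ≤ hmax → ¬ ConfidenceFails T k σ hmax θ g node r t m
  lip : ∀ x ∈ X, ∀ y ∈ X, |g x - g y| ≤ L * l1Dist x y
  diam : DiamBound T L δ
  exists_max : ∃ x ∈ X, g x = sSup (g '' X)

lemma GoodRun.sSup_le (h : GoodRun T k σ L δ hmax θ N node r g) (hK : 1 ≤ K) (hS : 1 ≤ S) {t : ℕ}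
    (ht : t < N) : sSup (g '' X) ≤ avg T g (node t) + 2 * ciWidth T k σ hmax θ node t (node t)
      + δ (node t).1 := by
  obtain ⟨x, hx, hgx⟩ := h.exists_max
  obtain ⟨m, hm, hxm⟩ := exists_mem_leaves h.run.selectsLeaves ht.le hx
  have hmn := isNode_of_mem_leaves h.run.selectsLeaves ht.le hm
  have htn := h.run.selectsLeaves.isNode ht
  have h1 := sub_le_avg hK hS hmn.1 h.lip h.diam hxm
  have h2 := h.conf t ht m hmn.1 hmn.2
  have h3 := h.conf t ht _ htn.1 htn.2
  have h4 := (h.run t ht).2 m hm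
  simp only [ConfidenceFails, not_lt] at h2 h3
  have h5 := (abs_le.1 h2).2
  have h6 := (abs_le.1 h3).1
  simp only [bValue] at h4
  linarith

/-- Expanded nodes are near-optimal. -/
lemma GoodRun.regret_le (h : GoodRun T k σ L δ hmax θ N node r g) (hK : 1 ≤ K) (hS : 1 ≤ S)
    (hm : m ∈ expandedNodes T k σ δ hmax θ N node) : regret T g m ≤ 3 * δ m.1 := by
  obtain ⟨t, ht, he, rfl⟩ := hm
  have h1 := h.sSup_le hK hS ht
  have h2 := he.1
  rw [regret]
  linarith

lemma GoodRun.regret_root_le (h : GoodRun T k σ L δ hmax θ N node r g) (hK : 1 ≤ K) (hS : 1 ≤ S) :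
    regret T g (0, 0) ≤ δ 0 := by
  obtain ⟨x, hx, hgx⟩ := h.exists_max
  have h1 := sub_le_avg (m := (0, 0)) hK hS (by simp [IsNode]) h.lip h.diam
    (y := x) (by rwa [T.cell_root])
  rw [regret]
  linarith

/-- Near-optimal nodes of the same depth are controlled by the packing bound. -/
lemma card_le_of_regret_le (hK : 1 ≤ K) (hS : 1 ≤ S) {l : ℕ} (hδ : 0 < δ l)
    (hδ0 : δ l ≤ δ 0)
    (hw : WellShaped T ν δ) (hC : PackingBound X g (ν / 3) (3 * δ 0) d C) {E : Finset (ℕ × ℕ)}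
    (hE : ∀ m ∈ E, m.1 = l ∧ IsNode K m ∧ regret T g m ≤ 3 * δ l) :
    (E.card : ℝ) ≤ C * (3 * δ l) ^ (-d) := by
  classical
  have hex : ∀ m : ℕ × ℕ, ∃ s, avg T g m ≤ g (T.rep m s) := fun m => exists_avg_le hS
  choose s hs using hex
  have hdisj : ∀ m ∈ E, ∀ m' ∈ E, m ≠ m' → Disjoint (T.cell m) (T.cell m') := by
    intro m hm m' hm' hne
    obtain ⟨h1, h2, -⟩ := hE m hm
    obtain ⟨h1', h2', -⟩ := hE m' hm'
    obtain ⟨a, i⟩ := m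
    obtain ⟨b, i'⟩ := m'
    obtain rfl : a = l := h1
    obtain rfl : b = a := h1'
    exact T.disjoint_cell hK h2 h2' fun he => hne (by rw [he])
  have hmem : ∀ m ∈ E, T.rep m (s m) ∈ T.cell m := fun m hm => T.rep_mem m.1 m.2 (hE m hm).2.1 _
  have hinj : Set.InjOn (fun m => T.rep m (s m)) E := by
    intro m hm m' hm' he
    by_contra hne
    refine Set.disjoint_left.1 (hdisj m hm m' hm' hne) (hmem m hm) ?_
    have he' : T.rep m (s m) = T.rep m' (s m') := he
    rw [he']
    exact hmem m' hm'
  have hball : ∀ m ∈ E, l1Ball X (T.rep m (s m)) (ν / 3 * (3 * δ l)) ⊆ T.cell m := by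
    intro m hm
    have h1 := hw m.1 m.2 (hE m hm).2.1 (s m)
    rw [(hE m hm).1] at h1
    rw [show ν / 3 * (3 * δ l) = ν * δ l by ring]
    have e : (l, m.2) = m := by rw [← (hE m hm).1]
    rwa [e] at h1
  have := hC (3 * δ l) (by positivity) (by linarith) (E.image fun m => T.rep m (s m)) ?_ ?_
  · rwa [Finset.card_image_of_injOn hinj] at this
  · intro x hx
    obtain ⟨m, hm, rfl⟩ := Finset.mem_image.1 hx
    refine ⟨T.cell_subset hK (hE m hm).2.1 (hmem m hm), ?_⟩
    have h1 := (hE m hm).2.2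
    rw [regret] at h1
    linarith [hs m]
  · intro x hx y hy hne
    obtain ⟨m, hm, rfl⟩ := Finset.mem_image.1 (Finset.mem_coe.1 hx)
    obtain ⟨m', hm', rfl⟩ := Finset.mem_image.1 (Finset.mem_coe.1 hy)
    exact (hdisj m hm m' hm' fun he => hne (by rw [he])).mono (hball m hm) (hball m' hm')

end Regret

section Counting

variable {D K S : ℕ} {X : Set (Fin D → ℝ)} {T : CellTree D K S X}
  {k : (Fin D → ℝ) → (Fin D → ℝ) → ℝ} {σ : ℝ} {δ : ℕ → ℝ} {hmax : ℕ} {θ : ℝ} {N : ℕ}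
  {node : ℕ → ℕ × ℕ} {r : ℕ → ℝ} {m : ℕ × ℕ}

/-- Repeated observations of a node reduce its posterior variance. -/
def VarianceReduction (T : CellTree D K S X) (k : (Fin D → ℝ) → (Fin D → ℝ) → ℝ) (σ : ℝ) : Prop :=
  ∀ (n : ℕ) (past : Fin n → ℕ × ℕ) (m : ℕ × ℕ), (∀ i, IsNode K (past i)) → IsNode K m →
    ∀ I : Finset (Fin n), I.Nonempty → (∀ i ∈ I, past i = m) →
      avg T (fun x => avg T (postCov T k σ past x) m) m ≤ σ ^ 2 / I.card

/-- The number of times a node of non-maximal depth is selected. -/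
lemma card_filter_node_eq_le (hs : SelectsLeaves T k σ δ hmax θ N node)
    (hvar : VarianceReduction T k σ) (hθ : 0 < θ) (hθ1 : θ < 1) (hN : 1 ≤ N)
    (hδ : 0 < δ m.1) (hm : m.1 < hmax) :
    (((Finset.range N).filter fun t => node t = m).card : ℝ) ≤
      beta K hmax θ N * σ ^ 2 / δ m.1 ^ 2 + 2 := by
  classical
  set A := beta K hmax θ N * σ ^ 2 / δ m.1 ^ 2 with hA
  have hβN := beta_pos (K := K) (hmax := hmax) hθ hθ1 hN
  have hA0 : 0 ≤ A := by positivity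
  let V := ((Finset.range N).filter fun t => node t = m).filter
    fun t => Expands T k σ δ hmax θ node t
  let U := ((Finset.range N).filter fun t => node t = m).filter
    fun t => ¬ Expands T k σ δ hmax θ node t
  have hcard : ((Finset.range N).filter fun t => node t = m).card = V.card + U.card :=
    (Finset.card_filter_add_card_filter_not _).symm
  have hV : V.card ≤ 1 := by
    refine Finset.card_le_one.2 fun s hs' t ht' => ?_
    simp only [V, Finset.mem_filter, Finset.mem_range] at hs' ht'
    exact eq_of_expands_of_node_eq hs hs'.1.1 ht'.1.1 hs'.2 ht'.2 (hs'.1.2.trans ht'.1.2.symm)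
  have hU : (U.card : ℝ) ≤ A + 1 := by
    rcases U.eq_empty_or_nonempty with hemp | hne
    · rw [hemp]; simp; linarith
    set t := U.max' hne with ht
    have htU : t ∈ U := U.max'_mem hne
    have htU' := htU
    simp only [U, Finset.mem_filter, Finset.mem_range] at htU'
    obtain ⟨⟨htN, htm⟩, hte⟩ := htU'
    have hlt : ∀ s ∈ U, s ≠ t → s < t := fun s hs hst => lt_of_le_of_ne (U.le_max' s hs) hst
    let I : Finset (Fin t) := Finset.univ.filter fun s => (s : ℕ) ∈ U
    have hI : I.card + 1 = U.card := by
      have h1 : I.map Fin.valEmbedding = U.erase t := by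
        ext s
        simp only [I, Finset.mem_map, Finset.mem_filter, Finset.mem_univ, true_and,
          Fin.valEmbedding_apply, Finset.mem_erase]
        constructor
        · rintro ⟨a, ha, rfl⟩
          exact ⟨a.2.ne, ha⟩
        · rintro ⟨h2, h3⟩
          exact ⟨⟨s, hlt s h3 h2⟩, h3, rfl⟩
      rw [← Finset.card_map Fin.valEmbedding, h1, Finset.card_erase_add_one htU]
    rw [← hI]
    push_cast
    have hmn := hs.isNode htN
    rw [htm] at hmn
    rcases I.eq_empty_or_nonempty with hIe | hIne
    · rw [hIe]; simp; linarith
    have hc : (0 : ℝ) < I.card := by exact_mod_cast hIne.card_pos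
    have hv := hvar t (fun s => node s) m (fun i => (hs.isNode (i.2.trans htN)).1) hmn.1 I hIne
      fun i hi => by
        simp only [I, U, Finset.mem_filter] at hi
        exact hi.2.1.2
    set s2 := avg T (fun x => avg T (postCov T k σ (fun s : Fin t => node s) x) m) m with hs2
    have hci : δ m.1 < √(beta K hmax θ (t + 1)) * √s2 := by
      by_contra! hcon
      refine hte ⟨?_, htm ▸ hm⟩
      rw [htm]
      exact hcon
    rw [← Real.sqrt_mul' _ (by
      by_contra! hneg
      rw [Real.sqrt_eq_zero_of_nonpos hneg.le, mul_zero] at hci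
      linarith), Real.lt_sqrt hδ.le] at hci
    have hβt := beta_pos (K := K) (hmax := hmax) hθ hθ1 (Nat.le_add_left 1 t)
    have hmono := beta_mono (K := K) (hmax := hmax) hθ (Nat.le_add_left 1 t) htN
    have h1 : δ m.1 ^ 2 ≤ beta K hmax θ N * (σ ^ 2 / I.card) :=
      hci.le.trans ((mul_le_mul_of_nonneg_left hv hβt.le).trans
        (mul_le_mul_of_nonneg_right hmono (by positivity)))
    have h2 : (I.card : ℝ) ≤ A := by
      rw [hA, le_div_iff₀ (by positivity)]
      calc (I.card : ℝ) * δ m.1 ^ 2 ≤ I.card * (beta K hmax θ N * (σ ^ 2 / I.card)) := by gcongr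
        _ = beta K hmax θ N * σ ^ 2 := by field_simp
    linarith
  rw [hcard]
  push_cast
  have hV' : (V.card : ℝ) ≤ 1 := by exact_mod_cast hV
  linarith

open Classical in
/-- The finite set of expanded nodes. -/
def expandedFinset (T : CellTree D K S X) (k : (Fin D → ℝ) → (Fin D → ℝ) → ℝ) (σ : ℝ) (δ : ℕ → ℝ)
    (hmax : ℕ) (θ : ℝ) (N : ℕ) (node : ℕ → ℕ × ℕ) : Finset (ℕ × ℕ) :=
  ((Finset.range N).filter fun t => Expands T k σ δ hmax θ node t).image node

lemma mem_expandedFinset : m ∈ expandedFinset T k σ δ hmax θ N node ↔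
    m ∈ expandedNodes T k σ δ hmax θ N node := by
  simp only [expandedFinset, expandedNodes, Finset.mem_image, Finset.mem_filter, Finset.mem_range,
    Set.mem_ofPred_eq, and_assoc]

/-- Bounding the budget by the numbers of selections of the root and of the children of the
expanded nodes. -/
lemma budget_le_sum (hs : SelectsLeaves T k σ δ hmax θ N node) {u : ℕ → ℝ}
    (hu : ∀ m, m = (0, 0) ∨ (∃ e ∈ expandedNodes T k σ δ hmax θ N node, m ∈ children K e) →
      (((Finset.range N).filter fun t => node t = m).card : ℝ) ≤ u m.1) (hu0 : ∀ l, 0 ≤ u l) :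
    (N : ℝ) ≤ u 0 + ∑ e ∈ expandedFinset T k σ δ hmax θ N node, K * u (e.1 + 1) := by
  classical
  let fib : ℕ × ℕ → Finset ℕ := fun m => (Finset.range N).filter fun t => node t = m
  set E := expandedFinset T k σ δ hmax θ N node
  have hsub : Finset.range N ⊆ fib (0, 0) ∪ E.biUnion fun e => (children K e).biUnion fib := by
    intro t ht
    have ht' := Finset.mem_range.1 ht
    rcases exists_parent_of_mem_leaves (hs t ht') with h | ⟨e, he, h⟩
    · exact Finset.mem_union_left _ (Finset.mem_filter.2 ⟨ht, h⟩)
    · refine Finset.mem_union_right _ (Finset.mem_biUnion.2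
        ⟨e, mem_expandedFinset.2 (expandedNodes_mono ht'.le he), Finset.mem_biUnion.2
          ⟨node t, h, Finset.mem_filter.2 ⟨ht, rfl⟩⟩⟩)
  have h1 : N ≤ (fib (0, 0)).card + ∑ e ∈ E, ∑ m ∈ children K e, (fib m).card := by
    calc N = (Finset.range N).card := (Finset.card_range N).symm
      _ ≤ _ := Finset.card_le_card hsub
      _ ≤ (fib (0, 0)).card + (E.biUnion fun e => (children K e).biUnion fib).card :=
        Finset.card_union_le _ _
      _ ≤ _ := by
        gcongr
        exact Finset.card_biUnion_le.trans (Finset.sum_le_sum fun e _ => Finset.card_biUnion_le)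
  have h2 : (N : ℝ) ≤ (fib (0, 0)).card + ∑ e ∈ E, ∑ m ∈ children K e, ((fib m).card : ℝ) := by
    exact_mod_cast h1
  refine h2.trans (add_le_add (hu _ (.inl rfl)) (Finset.sum_le_sum fun e he => ?_))
  have h3 : ∀ m ∈ children K e, ((fib m).card : ℝ) ≤ u (e.1 + 1) := fun m hm =>
    depth_of_mem_children hm ▸ hu m (.inr ⟨e, mem_expandedFinset.1 he, hm⟩)
  refine (Finset.sum_le_card_nsmul _ _ _ h3).trans ?_
  rw [nsmul_eq_mul]
  have h4 : (children K e).card ≤ K := Finset.card_image_le.trans (Finset.card_range K).le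
  have h5 : ((children K e).card : ℝ) ≤ K := by exact_mod_cast h4
  exact mul_le_mul_of_nonneg_right h5 (hu0 _)

end Counting

end GPOO

end

noncomputable section

namespace GPOO

section Constants

variable {K hmax N : ℕ} {σ c ρ θ d C : ℝ}

lemma expDiam_pos (hc : 0 < c) (hρ : 0 < ρ) (l : ℕ) : 0 < expDiam c ρ l := by
  unfold expDiam; positivity

lemma expDiam_anti (hc : 0 < c) (hρ : 0 < ρ) (hρ1 : ρ < 1) {l l' : ℕ} (h : l ≤ l') :
    expDiam c ρ l' ≤ expDiam c ρ l := by
  unfold expDiam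
  exact mul_le_mul_of_nonneg_left (pow_le_pow_of_le_one hρ.le hρ1.le h) hc.le

/-- The largest term dominates a growing geometric sum. -/
lemma sum_expDiam_rpow_le (hc : 0 < c) (hρ : 0 < ρ) (hρ1 : ρ < 1) {p : ℝ} (hp : 0 < p) (H : ℕ) :
    ∑ l ∈ Finset.range (H + 1), expDiam c ρ l ^ (-p) ≤
      (1 - ρ ^ p)⁻¹ * expDiam c ρ H ^ (-p) := by
  have hu0 : 0 < ρ ^ p := Real.rpow_pos_of_pos hρ p
  have hu1 : ρ ^ p < 1 := Real.rpow_lt_one hρ.le hρ1 hp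
  have hstep : ∀ l, expDiam c ρ l ^ (-p) = ρ ^ p * expDiam c ρ (l + 1) ^ (-p) := by
    intro l
    have h1 : expDiam c ρ (l + 1) = ρ * expDiam c ρ l := by simp [expDiam, pow_succ]; ring
    rw [h1, Real.mul_rpow hρ.le (expDiam_pos hc hρ l).le, ← mul_assoc, ← Real.rpow_add hρ]
    simp
  have h1u : 0 < 1 - ρ ^ p := by linarith
  induction H with
  | zero =>
    rw [zero_add, Finset.sum_range_one]
    have := Real.rpow_nonneg (expDiam_pos hc hρ 0).le (-p)
    exact le_mul_of_one_le_left this ((one_le_inv₀ h1u).2 (by linarith))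
  | succ H ih =>
    rw [Finset.sum_range_succ]
    rw [hstep H] at ih
    refine (add_le_add_left ih _).trans (le_of_eq ?_)
    field_simp
    ring

lemma mul_rpow_mul_div_sq (hd : 0 < c) (s : ℝ) :
    C * (3 * c) ^ (-d) * (s / c ^ 2) = C * 3 ^ (-d) * s * c ^ (-(d + 2)) := by
  rw [Real.mul_rpow (by norm_num) hd.le, neg_add, Real.rpow_add hd, Real.rpow_neg hd.le 2,
    Real.rpow_two]
  ring

/-- The constant in the bound for the budget in terms of the depth `depthN`. -/
def depthConst (K : ℕ) (σ ρ d C : ℝ) : ℝ :=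
  K * (C * 3 ^ (-d) * σ ^ 2) * (1 - ρ ^ (d + 2))⁻¹

lemma depthConst_pos (hK : 1 ≤ K) (hσ : 0 < σ) (hρ : 0 < ρ) (hρ1 : ρ < 1) (hd : 0 ≤ d)
    (hC : 0 < C) : 0 < depthConst K σ ρ d C := by
  have hu1 : ρ ^ (d + 2) < 1 := Real.rpow_lt_one hρ.le hρ1 (by linarith)
  have h1u : 0 < 1 - ρ ^ (d + 2) := by linarith
  have hK' : (0 : ℝ) < K := by exact_mod_cast hK
  unfold depthConst
  positivity

lemma depthN_spec (hK : 1 ≤ K) (hσ : 0 < σ) (hc : 0 < c) (hρ : 0 < ρ) (hρ1 : ρ < 1) (hd : 0 ≤ d)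
    (hC : 0 < C) : (N : ℝ) / beta K hmax θ N ≤
      K * ∑ l ∈ Finset.range (depthN K hmax σ θ (expDiam c ρ) d C N + 1),
        C * (3 * expDiam c ρ l) ^ (-d) * (σ ^ 2 / expDiam c ρ l ^ 2) := by
  have hK' : (0 : ℝ) < K := by exact_mod_cast hK
  refine Nat.sInf_mem (s := {h : ℕ | (N : ℝ) / beta K hmax θ N ≤ K * ∑ l ∈ Finset.range (h + 1),
    C * (3 * expDiam c ρ l) ^ (-d) * (σ ^ 2 / expDiam c ρ l ^ 2)}) ?_
  set a := C * 3 ^ (-d) * σ ^ 2 * expDiam c ρ 0 ^ (-(d + 2)) with ha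
  have hδ0 := expDiam_pos hc hρ 0
  have ha0 : 0 < a := by positivity
  have hterm : ∀ l, a ≤ C * (3 * expDiam c ρ l) ^ (-d) * (σ ^ 2 / expDiam c ρ l ^ 2) := by
    intro l
    have hδl := expDiam_pos hc hρ l
    rw [mul_rpow_mul_div_sq hδl, ha]
    have := Real.rpow_le_rpow_of_nonpos hδl (expDiam_anti hc hρ hρ1 (Nat.zero_le l))
      (show -(d + 2) ≤ 0 by linarith)
    gcongr
  obtain ⟨n, hn⟩ := exists_nat_ge ((N : ℝ) / beta K hmax θ N / (K * a))
  refine ⟨n, ?_⟩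
  rw [div_le_iff₀ (by positivity)] at hn
  have h1 := Finset.card_nsmul_le_sum (Finset.range (n + 1)) _ a fun l _ => hterm l
  rw [Finset.card_range, nsmul_eq_mul] at h1
  push_cast at h1
  calc (N : ℝ) / beta K hmax θ N ≤ n * (K * a) := hn
    _ ≤ K * ((n + 1) * a) := by nlinarith [mul_pos hK' ha0]
    _ ≤ _ := by gcongr

lemma budget_le_depthConst (hK : 1 ≤ K) (hσ : 0 < σ) (hc : 0 < c) (hρ : 0 < ρ) (hρ1 : ρ < 1)
    (hd : 0 ≤ d) (hC : 0 < C) : (N : ℝ) / beta K hmax θ N ≤ depthConst K σ ρ d C *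
      expDiam c ρ (depthN K hmax σ θ (expDiam c ρ) d C N) ^ (-(d + 2)) := by
  refine (depthN_spec hK hσ hc hρ hρ1 hd hC).trans ?_
  set H := depthN K hmax σ θ (expDiam c ρ) d C N
  simp only [mul_rpow_mul_div_sq (expDiam_pos hc hρ _)]
  rw [← Finset.mul_sum, depthConst]
  have h1 := sum_expDiam_rpow_le hc hρ hρ1 (show 0 < d + 2 by linarith) H
  calc _ ≤ (K : ℝ) * (C * 3 ^ (-d) * σ ^ 2 * ((1 - ρ ^ (d + 2))⁻¹ *
        expDiam c ρ H ^ (-(d + 2)))) := by gcongr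
    _ = _ := by ring

/-- Bound for the number of selections of a node, relative to `β / δ²`. -/
def selConst (σ c : ℝ) : ℝ := σ ^ 2 + c ^ 2 / Real.log (3 / 2)

lemma selConst_pos (hσ : 0 < σ) : 0 < selConst σ c := by
  have := log_three_halves_pos
  unfold selConst
  positivity

lemma selections_le (hc : 0 < c) (hρ : 0 < ρ) (hρ1 : ρ < 1) (hθ : 0 < θ) (hθ1 : θ < 1)
    (hN : 1 ≤ N) (l : ℕ) :
    beta K hmax θ N * σ ^ 2 / expDiam c ρ l ^ 2 + 2 ≤
      beta K hmax θ N * selConst σ c / expDiam c ρ l ^ 2 := by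
  have hδ := expDiam_pos hc hρ l
  have hlog := log_three_halves_pos
  have hβ := le_beta (K := K) (hmax := hmax) hθ hθ1 hN
  have hδc : expDiam c ρ l ≤ c := by
    simpa [expDiam] using expDiam_anti hc hρ hρ1 (Nat.zero_le l)
  have hsq : expDiam c ρ l ^ 2 ≤ c ^ 2 := by gcongr
  rw [← sub_nonneg]
  have e : beta K hmax θ N * selConst σ c / expDiam c ρ l ^ 2 -
      (beta K hmax θ N * σ ^ 2 / expDiam c ρ l ^ 2 + 2) =
      (beta K hmax θ N * c ^ 2 - 2 * Real.log (3 / 2) * expDiam c ρ l ^ 2) /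
        (Real.log (3 / 2) * expDiam c ρ l ^ 2) := by
    unfold selConst
    field_simp
    ring
  rw [e]
  refine div_nonneg (sub_nonneg.2 ?_) (by positivity)
  exact mul_le_mul hβ hsq (by positivity) (by linarith)

/-- The constant in the bound for the budget in terms of the depth of the recommended node. -/
def budgetConst (K : ℕ) (σ c ρ d C : ℝ) : ℝ :=
  selConst σ c * c ^ d + K * (selConst σ c / ρ ^ 2) * (C * 3 ^ (-d)) * (1 - ρ ^ (d + 2))⁻¹

lemma budgetConst_pos (hσ : 0 < σ) (hc : 0 < c) (hρ : 0 < ρ) (hρ1 : ρ < 1)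
    (hd : 0 ≤ d) (hC : 0 < C) : 0 < budgetConst K σ c ρ d C := by
  have hu1 : ρ ^ (d + 2) < 1 := Real.rpow_lt_one hρ.le hρ1 (by linarith)
  have h1u : 0 < 1 - ρ ^ (d + 2) := by linarith
  have := selConst_pos (c := c) hσ
  unfold budgetConst
  positivity

/-- Inverting a power bound for the budget. -/
lemma le_mul_rpow_of_le {x G δ p : ℝ} (hx : 0 < x) (hG : 0 < G) (hδ : 0 < δ) (hp : 0 < p)
    (h : x ≤ G * δ ^ (-p)) : δ ≤ G ^ (1 / p) * x ^ (-(1 / p)) := by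
  rw [Real.rpow_neg hδ.le, ← div_eq_mul_inv, le_div_iff₀ (Real.rpow_pos_of_pos hδ p), mul_comm,
    ← le_div_iff₀ hx] at h
  have h1 := Real.rpow_le_rpow (by positivity) h (show 0 ≤ 1 / p by positivity)
  rwa [← Real.rpow_mul hδ.le, mul_one_div_cancel hp.ne', Real.rpow_one, Real.div_rpow hG.le hx.le,
    div_eq_mul_inv, ← Real.rpow_neg hx.le] at h1

/-- The constant in the regret bound. -/
def regretConst (K : ℕ) (σ c ρ d C : ℝ) : ℝ :=
  3 * (depthConst K σ ρ d C + budgetConst K σ c ρ d C) ^ (1 / (d + 2))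

end Constants

section Main

variable {D K S : ℕ} {X : Set (Fin D → ℝ)} {T : CellTree D K S X}
  {k : (Fin D → ℝ) → (Fin D → ℝ) → ℝ} {σ c ρ : ℝ} {hmax : ℕ} {θ : ℝ} {N : ℕ}
  {node : ℕ → ℕ × ℕ} {r : ℕ → ℝ} {m : ℕ × ℕ} {g : (Fin D → ℝ) → ℝ} {L ν d C : ℝ}

/-- If no node of maximal depth has been selected, the budget is bounded in terms of the maximal
depth of an expanded node. -/
lemma GoodRun.budget_le (h : GoodRun T k σ L (expDiam c ρ) hmax θ N node r g) (hK : 1 ≤ K)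
    (hS : 1 ≤ S) (hσ : 0 < σ) (hc : 0 < c) (hρ : 0 < ρ) (hρ1 : ρ < 1) (hθ : 0 < θ) (hθ1 : θ < 1)
    (hN : 1 ≤ N) (hvar : VarianceReduction T k σ)
    (hw : WellShaped T ν (expDiam c ρ)) (hd : 0 ≤ d) (hC0 : 0 < C)
    (hC : PackingBound X g (ν / 3) (3 * expDiam c ρ 0) d C) {H : ℕ}
    (hH : ∀ e ∈ expandedNodes T k σ (expDiam c ρ) hmax θ N node, e.1 ≤ H ∧ e.1 + 1 < hmax)
    (hmax0 : 0 < hmax) :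
    (N : ℝ) / beta K hmax θ N ≤ budgetConst K σ c ρ d C * expDiam c ρ H ^ (-(d + 2)) := by
  classical
  have hs := h.run.selectsLeaves
  have hβ := beta_pos (K := K) (hmax := hmax) hθ hθ1 hN
  have hsel := selConst_pos (c := c) hσ
  have hδ := expDiam_pos hc hρ
  have hu1 : ρ ^ (d + 2) < 1 := Real.rpow_lt_one hρ.le hρ1 (by linarith)
  have h1u : 0 < 1 - ρ ^ (d + 2) := by linarith
  set β := beta K hmax θ N with hβdef
  set E := expandedFinset T k σ (expDiam c ρ) hmax θ N node with hEdef
  have h1 := budget_le_sum hs (u := fun l => β * selConst σ c / expDiam c ρ l ^ 2)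
    (fun m hm => by
      have hm' : m.1 < hmax := by
        rcases hm with rfl | ⟨e, he, hme⟩
        · exact hmax0
        · rw [depth_of_mem_children hme]; exact (hH e he).2
      exact (card_filter_node_eq_le hs hvar hθ hθ1 hN (hδ m.1) hm').trans
        (selections_le hc hρ hρ1 hθ hθ1 hN m.1)) fun l => by positivity
  have hsum : ∑ e ∈ E, (K : ℝ) * (β * selConst σ c / expDiam c ρ (e.1 + 1) ^ 2) ≤
      ∑ l ∈ Finset.range (H + 1),
        C * (3 * expDiam c ρ l) ^ (-d) * (K * (β * selConst σ c / expDiam c ρ (l + 1) ^ 2)) := by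
    rw [← Finset.sum_fiberwise_of_maps_to (s := E) (t := Finset.range (H + 1)) (g := fun e => e.1)
      fun e he => Finset.mem_range.2 (Nat.lt_succ_of_le (hH e (mem_expandedFinset.1 he)).1)]
    refine Finset.sum_le_sum fun l _ => ?_
    have h2 : ∀ e ∈ E.filter (fun e => e.1 = l),
        (K : ℝ) * (β * selConst σ c / expDiam c ρ (e.1 + 1) ^ 2) =
          K * (β * selConst σ c / expDiam c ρ (l + 1) ^ 2) := fun e he => by
      rw [(Finset.mem_filter.1 he).2]
    rw [Finset.sum_congr rfl h2, Finset.sum_const, nsmul_eq_mul]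
    refine mul_le_mul_of_nonneg_right ?_ (by positivity)
    refine card_le_of_regret_le hK hS (hδ l) (expDiam_anti hc hρ hρ1 (Nat.zero_le l)) hw hC ?_
    intro e he
    obtain ⟨heE, rfl⟩ := Finset.mem_filter.1 he
    have he' := mem_expandedFinset.1 heE
    refine ⟨rfl, ?_, h.regret_le hK hS he'⟩
    obtain ⟨t, ht, -, rfl⟩ := he'
    exact (hs.isNode ht).1
  have hterm : ∀ l, C * (3 * expDiam c ρ l) ^ (-d) *
      (K * (β * selConst σ c / expDiam c ρ (l + 1) ^ 2)) =
      β * (K * (selConst σ c / ρ ^ 2) * (C * 3 ^ (-d))) * expDiam c ρ l ^ (-(d + 2)) := by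
    intro l
    have h3 : expDiam c ρ (l + 1) = ρ * expDiam c ρ l := by simp [expDiam, pow_succ]; ring
    have h4 := mul_rpow_mul_div_sq (C := C) (d := d) (hδ l) (K * (β * selConst σ c / ρ ^ 2))
    rw [h3]
    have h5 : (K : ℝ) * (β * selConst σ c / (ρ * expDiam c ρ l) ^ 2) =
        K * (β * selConst σ c / ρ ^ 2) / expDiam c ρ l ^ 2 := by
      have := hδ l
      field_simp
    rw [h5, h4]
    ring
  rw [Finset.sum_congr rfl fun l _ => hterm l,
    ← Finset.mul_sum (Finset.range (H + 1))] at hsum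
  have hgeo := sum_expDiam_rpow_le hc hρ hρ1 (show 0 < d + 2 by linarith) H
  have h0 : β * selConst σ c / expDiam c ρ 0 ^ 2 ≤
      β * (selConst σ c * c ^ d) * expDiam c ρ H ^ (-(d + 2)) := by
    have h6 := Real.rpow_le_rpow_of_nonpos (hδ H) (expDiam_anti hc hρ hρ1 (Nat.zero_le H))
      (show -(d + 2) ≤ 0 by linarith)
    have h7 : expDiam c ρ 0 = c := by simp [expDiam]
    calc β * selConst σ c / expDiam c ρ 0 ^ 2
        = β * (selConst σ c * c ^ d) * expDiam c ρ 0 ^ (-(d + 2)) := by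
          rw [h7, neg_add, Real.rpow_add hc, Real.rpow_neg hc.le, Real.rpow_neg hc.le,
            Real.rpow_two]
          have := (Real.rpow_pos_of_pos hc d).ne'
          field_simp
      _ ≤ _ := by gcongr
  rw [div_le_iff₀ hβ]
  calc (N : ℝ) ≤ _ := h1
    _ ≤ β * (selConst σ c * c ^ d) * expDiam c ρ H ^ (-(d + 2)) +
        β * (K * (selConst σ c / ρ ^ 2) * (C * 3 ^ (-d))) *
          ((1 - ρ ^ (d + 2))⁻¹ * expDiam c ρ H ^ (-(d + 2))) := by
        refine add_le_add h0 (hsum.trans ?_)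
        gcongr
    _ = _ := by unfold budgetConst; ring

/-- Regret of the recommended node. -/
lemma GoodRun.regret_recommended_le (h : GoodRun T k σ L (expDiam c ρ) hmax θ N node r g)
    (hK : 1 ≤ K) (hS : 1 ≤ S) (hσ : 0 < σ) (hc : 0 < c) (hρ : 0 < ρ) (hρ1 : ρ < 1) (hθ : 0 < θ)
    (hθ1 : θ < 1) (hN : 1 ≤ N) (hvar : VarianceReduction T k σ)
    (hw : WellShaped T ν (expDiam c ρ)) (hd : 0 ≤ d) (hC0 : 0 < C)
    (hC : PackingBound X g (ν / 3) (3 * expDiam c ρ 0) d C)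
    (hdepth : depthN K hmax σ θ (expDiam c ρ) d C N < hmax)
    (hm : IsRecommended T k σ (expDiam c ρ) hmax θ N node m) :
    regret T g m ≤ regretConst K σ c ρ d C *
      ((N : ℝ) / beta K hmax θ N) ^ (-(1 / (d + 2))) := by
  have hδ := expDiam_pos hc hρ
  have hx : 0 < (N : ℝ) / beta K hmax θ N :=
    div_pos (by exact_mod_cast hN) (beta_pos hθ hθ1 hN)
  have hdc := depthConst_pos hK hσ hρ hρ1 hd hC0
  have hbc := budgetConst_pos (K := K) hσ hc hρ hρ1 hd hC0
  have hreg : regret T g m ≤ 3 * expDiam c ρ m.1 := by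
    rcases hm with hm | ⟨-, rfl⟩
    · exact h.regret_le hK hS hm.1
    · exact (h.regret_root_le hK hS).trans (by linarith [hδ 0])
  have hle : ∀ e ∈ expandedNodes T k σ (expDiam c ρ) hmax θ N node, e.1 ≤ m.1 := by
    rcases hm with hm | ⟨hm, -⟩
    · exact hm.2
    · simp [hm]
  have key : (N : ℝ) / beta K hmax θ N ≤
      (depthConst K σ ρ d C + budgetConst K σ c ρ d C) * expDiam c ρ m.1 ^ (-(d + 2)) := by
    have hpos := Real.rpow_pos_of_pos (hδ m.1) (-(d + 2))
    by_cases hcase : m.1 + 1 < hmax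
    · refine (h.budget_le hK hS hσ hc hρ hρ1 hθ hθ1 hN hvar hw hd hC0 hC
        (fun e he => ⟨hle e he, by have := hle e he; omega⟩) (by omega)).trans ?_
      gcongr
      linarith
    · refine (budget_le_depthConst hK hσ hc hρ hρ1 hd hC0).trans ?_
      have h1 := Real.rpow_le_rpow_of_nonpos (hδ m.1)
        (expDiam_anti hc hρ hρ1 (show depthN K hmax σ θ (expDiam c ρ) d C N ≤ m.1 by omega))
        (show -(d + 2) ≤ 0 by linarith)
      exact mul_le_mul (by linarith) h1 (Real.rpow_pos_of_pos (hδ _) _).le (by linarith)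
  have h2 := le_mul_rpow_of_le hx (by linarith) (hδ m.1) (show 0 < d + 2 by linarith) key
  rw [regretConst, mul_assoc]
  linarith

end Main

section Event

variable {D K S : ℕ} {X : Set (Fin D → ℝ)} {Ω : Type*} {𝒢 mΩ : MeasurableSpace Ω}
  {P : Measure Ω} [IsProbabilityMeasure P]
  {k : (Fin D → ℝ) → (Fin D → ℝ) → ℝ} {σ L : ℝ} {f : (Fin D → ℝ) → Ω → ℝ}
  {noise : ℕ → Ω → ℝ} {T : CellTree D K S X} {N : ℕ}
  {node : ℕ → Ω → ℕ × ℕ} {r : ℕ → Ω → ℝ} {hmax : ℕ} {θ : ℝ} {δ : ℕ → ℝ}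

/-- With high probability the run is good. -/
lemma exists_goodRun_event (hX : IsCompact X) (hXc : Convex ℝ X) (hXn : X.Nonempty)
    (h : IsModel X k σ f noise P) (hC1 : ∀ᵐ ω ∂P, ContDiffOn ℝ 1 (fun x => f x ω) X)
    (hσ : 0 < σ) (hK : 1 ≤ K) (h𝒢 : 𝒢 ≤ mΩ) (h𝒢i : Indep 𝒢 (IsModel.sigmaAlg X f noise) P)
    (hr : ∀ t ω, r t ω = avg T (fun x => f x ω) (node t ω) + noise t ω)
    (hn : ∀ t < N, ∀ m, MeasurableSet[𝒢 ⊔ ⨆ s ∈ Finset.range t,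
      MeasurableSpace.comap (r s) inferInstance] {ω | node t ω = m})
    (hrun : ∀ ω, IsRun T k σ δ hmax θ N (fun t => node t ω) (fun t => r t ω))
    (hdiam : DiamBound T L δ) (hθ : 0 < θ) (hθ1 : θ < 1) :
    ∃ ξ : Set Ω, MeasurableSet ξ ∧
      1 - θ - P.real {ω | SteepOn X (fun x => f x ω) L} ≤ P.real ξ ∧
      ∀ ω ∈ ξ, GoodRun T k σ L δ hmax θ N (fun t => node t ω) (fun t => r t ω) fun x => f x ω := by
  have hconf := measure_exists_confidenceFails_le (hmax := hmax) h hσ hK h𝒢 h𝒢i hr hn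
    (fun t ht ω => ((hrun ω).selectsLeaves.isNode ht).1) hθ hθ1
  set B₁ := {ω | SteepOn X (fun x => f x ω) L}
  set B₂ := {ω | ∃ t < N, ∃ m, IsNode K m ∧ m.1 ≤ hmax ∧ ConfidenceFails T k σ hmax θ
    (fun x => f x ω) (fun s => node s ω) (fun s => r s ω) t m}
  set B₃ := {ω | ¬ ContDiffOn ℝ 1 (fun x => f x ω) X}
  have hB₃ : P B₃ = 0 := hC1
  have hmeas : MeasurableSet (toMeasurable P (B₁ ∪ B₂ ∪ B₃)) := measurableSet_toMeasurable _ _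
  refine ⟨(toMeasurable P (B₁ ∪ B₂ ∪ B₃))ᶜ, hmeas.compl, ?_, fun ω hω => ?_⟩
  · have h1 : P.real (B₁ ∪ B₂ ∪ B₃) ≤ P.real B₁ + θ := by
      have h2 : P.real B₂ ≤ θ := ENNReal.toReal_le_of_le_ofReal hθ.le hconf
      have h3 : P.real B₃ = 0 := by simp [Measure.real, hB₃]
      have h4 := measureReal_union_le (μ := P) (B₁ ∪ B₂) B₃
      have h5 := measureReal_union_le (μ := P) B₁ B₂
      linarith
    have h6 : P.real (toMeasurable P (B₁ ∪ B₂ ∪ B₃)) = P.real (B₁ ∪ B₂ ∪ B₃) := by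
      rw [Measure.real, measure_toMeasurable, Measure.real]
    rw [probReal_compl_eq_one_sub hmeas, h6]
    linarith
  have hω' : ω ∉ B₁ ∪ B₂ ∪ B₃ := fun hmem => hω (subset_toMeasurable P _ hmem)
  simp only [Set.mem_union, not_or] at hω'
  obtain ⟨⟨hω1, hω2⟩, hω3⟩ := hω'
  have hC1ω : ContDiffOn ℝ 1 (fun x => f x ω) X := not_not.1 hω3
  exact
    { run := hrun ω
      conf := fun t ht m hm hmd hfail => hω2 ⟨t, ht, m, hm, hmd, hfail⟩
      lip := fun x hx y hy => abs_sub_le_of_not_steepOn hXc hC1ω hω1 hx hy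
      diam := hdiam
      exists_max := by
        obtain ⟨x, hx, hxe⟩ := hX.exists_sSup_image_eq hXn hC1ω.continuousOn
        exact ⟨x, hx, hxe.symm⟩ }

end Event

end GPOO

end

theorem mainTheorem2 (K : ℕ) (hK : 1 ≤ K) (σ c ρ : ℝ) (hσ : 0 < σ) (hc : 0 < c)
    (hρ0 : 0 < ρ) (hρ1 : ρ < 1) :
    -- the constants are functions of `d` and `C`, given `K`, `σ`, `c`, `ρ`
    ∃ c₁ c₂ : ℝ → ℝ → ℝ,
    (∀ d C : ℝ, 0 ≤ d → 0 < C → 0 < c₁ d C ∧ 0 < c₂ d C) ∧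
    ∀ {D : ℕ} {X : Set (Fin D → ℝ)} (_ : IsCompact X) (_ : Convex ℝ X)
      (_ : (interior X).Nonempty)
      {Ω : Type*} [mΩ : MeasurableSpace Ω] (P : Measure Ω) [IsProbabilityMeasure P]
      -- the reward function: a centred Gaussian process on `X` with covariance `k`, `C¹` paths
      (k : (Fin D → ℝ) → (Fin D → ℝ) → ℝ) (f : (Fin D → ℝ) → Ω → ℝ)
      (_ : ∀ x ∈ X, Measurable (f x))
      (_ : IsGaussianProcess (fun (x : X) => f x) P)
      (_ : ∀ x ∈ X, ∫ ω, f x ω ∂P = 0)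
      (_ : ∀ x ∈ X, ∀ y ∈ X, ∫ ω, f x ω * f y ω ∂P = k x y)
      (_ : ∀ᵐ ω ∂P, ContDiffOn ℝ 1 (fun x => f x ω) X),
    ∃ a b : ℝ, 0 < a ∧ 0 < b ∧
    (∀ L : ℝ, 0 < L →
      P.real {ω | GPOO.SteepOn X (fun x => f x ω) L} ≤ a * Real.exp (-(L ^ 2 * b / 2))) ∧
    ∀ -- the noise: independent `N(0, σ²)` variables, independent of `f`
      (noise : ℕ → Ω → ℝ) (_ : ∀ t, Measurable (noise t))
      (_ : ∀ t, P.map (noise t) = gaussianReal 0 (Real.toNNReal (σ ^ 2)))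
      (_ : iIndepFun noise P)
      (_ : Indep (⨆ x ∈ X, MeasurableSpace.comap (f x) inferInstance)
        (⨆ t, MeasurableSpace.comap (noise t) inferInstance) P)
      -- `𝒢`: independent randomness that may be used to break ties
      (𝒢 : MeasurableSpace Ω) (_ : 𝒢 ≤ mΩ)
      (_ : Indep 𝒢 ((⨆ x ∈ X, MeasurableSpace.comap (f x) inferInstance) ⊔
        (⨆ t, MeasurableSpace.comap (noise t) inferInstance)) P)
      -- the tree of cells
      {S : ℕ} (_ : 1 ≤ S) (T : GPOO.CellTree D K S X) (L ν : ℝ) (_ : 0 < L) (_ : 0 < ν)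
      (_ : GPOO.DiamBound T L (GPOO.expDiam c ρ)) (_ : GPOO.WellShaped T ν (GPOO.expDiam c ρ))
      -- a run of the algorithm with maximal depth `hmax`, error parameter `θ`, budget `N`
      (hmax : ℕ) (θ : ℝ) (_ : 0 < θ) (_ : θ < 1) (N : ℕ) (_ : 1 ≤ N)
      (node : ℕ → Ω → ℕ × ℕ) (r : ℕ → Ω → ℝ)
      (_ : ∀ t ω, r t ω = GPOO.avg T (fun x => f x ω) (node t ω) + noise t ω)
      (_ : ∀ t < N, ∀ m, MeasurableSet[𝒢 ⊔ ⨆ s ∈ Finset.range t,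
        MeasurableSpace.comap (r s) inferInstance] {ω | node t ω = m})
      (_ : ∀ ω, GPOO.IsRun T k σ (GPOO.expDiam c ρ) hmax θ N (fun t => node t ω)
        (fun t => r t ω)),
    ∃ ξ : Set Ω, MeasurableSet[mΩ] ξ ∧
      1 - θ - P.real {ω | GPOO.SteepOn X (fun x => f x ω) L} ≤ P.real ξ ∧
      ∀ ω ∈ ξ, ∀ d C : ℝ,
        GPOO.IsNearOptimalityDim X (fun x => f x ω) (ν / 3) (3 * GPOO.expDiam c ρ 0) d →
        0 < C → GPOO.PackingBound X (fun x => f x ω) (ν / 3) (3 * GPOO.expDiam c ρ 0) d C →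
        (N : ℝ) / GPOO.beta K hmax θ N ≤
          c₁ d C * (GPOO.expDiam c ρ
            (GPOO.depthN K hmax σ θ (GPOO.expDiam c ρ) d C N)) ^ (-(d + 2)) ∧
        (GPOO.depthN K hmax σ θ (GPOO.expDiam c ρ) d C N < hmax →
          ∀ m, GPOO.IsRecommended T k σ (GPOO.expDiam c ρ) hmax θ N (fun t => node t ω) m →
            GPOO.regret T (fun x => f x ω) m ≤
              c₂ d C * ((N : ℝ) / GPOO.beta K hmax θ N) ^ (-(1 / (d + 2)))) := by
  refine ⟨fun d C => GPOO.depthConst K σ ρ d C, fun d C => GPOO.regretConst K σ c ρ d C,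
    fun d C hd hC => ?_, ?_⟩
  · have h1 := GPOO.depthConst_pos hK hσ hρ0 hρ1 hd hC
    have h2 := GPOO.budgetConst_pos (K := K) hσ hc hρ0 hρ1 hd hC
    refine ⟨h1, ?_⟩
    unfold GPOO.regretConst
    positivity
  intro D X hX hXc hXi Ω mΩ P _ k f hf hG h0 hcov hC1
  obtain ⟨a, b, ha, hb, htail⟩ := GPOO.exists_steepOn_tail hX hXc hXi hG h0 hC1
  refine ⟨a, b, ha, hb, htail, ?_⟩
  intro noise hnm hnl hni hind
  have hM : GPOO.IsModel X k σ f noise P := ⟨hf, hG, h0, hcov, hnm, hnl, hni, hind⟩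
  have hvar : ∀ {S : ℕ} (T : GPOO.CellTree D K S X), GPOO.VarianceReduction T k σ :=
    fun T n past m hpast hm I hI hIm => hM.avg_postCov_le hσ hK hpast hm hI hIm
  intro 𝒢 h𝒢 h𝒢i S hS T L ν hL hν hdiam hw hmax θ hθ hθ1 N hN node r hr hn hrun
  obtain ⟨ξ, hξm, hξ, hgood⟩ := GPOO.exists_goodRun_event hX hXc (hXi.mono interior_subset) hM hC1
    hσ hK h𝒢 h𝒢i hr hn hrun hdiam hθ hθ1
  refine ⟨ξ, hξm, hξ, fun ω hω d C hd hC0 hC => ?_⟩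
  have hd0 : 0 ≤ d := hd.1.1
  exact ⟨GPOO.budget_le_depthConst hK hσ hc hρ0 hρ1 hd0 hC0, fun hdepth m hm =>
    (hgood ω hω).regret_recommended_le hK hS hσ hc hρ0 hρ1 hθ hθ1 hN (hvar T) hw hd0 hC0 hC
      hdepth hm⟩
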